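/- Let $D\subset\mathbb R^d$ be open and bounded, and let $$\mathcal A u=-\sum_{i,j=1}^d a^{ij}(x)\,u_{x_ix_j}+\sum_{i=1}^d b^i(x)\,u_{x_i}+c(x)\,u,\qquad a^{ij},b^i,c\in C^\infty(\mathbb R^d),$$ considered on $H^2(D)\cap H_0^1(D)$, be symmetric in $L^2(D)$, uniformly elliptic on $D$ and positive definite ($\langle\mathcal A v,v\rangle_{L^2(D)}>0$ for $v\neq0$). Let $\alpha\in(1/2,1)$. Then there is a constant $C>0$, depending only on $D$, $\mathcal A$ and $\alpha$, with the following property. Let $(\lambda_n,\phi_n)_{n\ge1}$ be an eigensystem of $\mathcal A$, that is, $\phi_n\in H^2(D)\cap H^1_0(D)$, $\mathcal A\phi_n=\lambda_n\phi_n$, $\lambda_1\le\lambda_2\le\cdots$, and $\{\phi_n\}$ is an orthonormal basis of $L^2(D)$. Let $T>0$, $f,g\in L^2(D)$, $h\in L^\infty(0,T)$, and let $\mathbb W$ be a standard Wiener process on a probability space. Write $f_n=\langle f,\phi_n\rangle_{L^2(D)}$, $g_n=\langle g,\phi_n\rangle_{L^2(D)}$, $E_{\alpha,\alpha}(z)=\sum_{k\ge0}z^k/\Gamma(k\alpha+\alpha)$,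 and $$I_{n,1}(t)=f_n\int_0^t(t-\tau)^{\alpha-1}E_{\alpha,\alpha}(-\lambda_n(t-\tau)^\alpha)\,h(\tau)\,d\tau,\qquad I_{n,2}(t)=g_n\int_0^t(t-\tau)^{\alpha-1}E_{\alpha,\alpha}(-\lambda_n(t-\tau)^\alpha)\,d\mathbb W(\tau),$$ where the second integral is a Wiener integral. Then the mild solution $$u(\cdot,t)=\sum_{n=1}^\infty\bigl(I_{n,1}(t)+I_{n,2}(t)\bigr)\phi_n,\qquad t\in[0,T],$$ exists as a jointly measurable $L^2(D)$-valued process (for each $t$ the series converges in $L^2(D)$ almost surely), and every such process satisfies $$\mathbb E\|u\|^2_{L^2(D\times[0,T])}\le C\Bigl(\|h\|^2_{L^2(0,T)}\|f\|^2_{L^2(D)}+T^{2\alpha}\|g\|^2_{L^2(D)}\Bigr).$$ -/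

import Mathlib

open MeasureTheory ProbabilityTheory Filter Set
open scoped NNReal ENNReal Topology

noncomputable section

namespace SFDE

/-! ### Function spaces on a domain `D ⊆ ℝᵈ` -/

/-- `ℝᵈ` with its Euclidean norm. -/
abbrev Space (d : ℕ) : Type := EuclideanSpace ℝ (Fin d)

/-- The real Hilbert space `L²(D)`. -/
abbrev L2 {d : ℕ} (D : Set (Space d)) : Type := Lp ℝ 2 (volume.restrict D)

/-- Classical partial derivative `∂ψ/∂xᵢ`. -/
def partialDeriv {d : ℕ} (i : Fin d) (ψ : Space d → ℝ) (x : Space d) : ℝ :=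
  fderiv ℝ ψ x (EuclideanSpace.single i 1)

/-- `ψ ∈ C_c^∞(D)`. -/
structure IsTest {d : ℕ} (D : Set (Space d)) (ψ : Space d → ℝ) : Prop where
  smooth : ContDiff ℝ ((⊤ : ℕ∞) : WithTop ℕ∞) ψ
  compact : HasCompactSupport ψ
  support : tsupport ψ ⊆ D

/-- `v` is the weak partial derivative `∂u/∂xᵢ` on `D`. -/
def IsWeakPartial {d : ℕ} (D : Set (Space d)) (i : Fin d) (u v : L2 D) : Prop :=
  ∀ ψ : Space d → ℝ, IsTest D ψ →
    ∫ x in D, u x * partialDeriv i ψ x = - ∫ x in D, v x * ψ x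

/-- `u ∈ H¹₀(D)`: `u` is a limit of functions of `C_c^∞(D)` in the `H¹(D)` norm. -/
def MemH10 {d : ℕ} (D : Set (Space d)) (u : L2 D) : Prop :=
  ∃ (p : Fin d → L2 D) (ψ : ℕ → Space d → ℝ),
    (∀ i, IsWeakPartial D i u (p i)) ∧
    (∀ m, IsTest D (ψ m)) ∧
    Tendsto (fun m => eLpNorm (fun x => ψ m x - u x) 2 (volume.restrict D)) atTop (𝓝 0) ∧
    ∀ i, Tendsto (fun m => eLpNorm (fun x => partialDeriv i (ψ m) x - p i x) 2
      (volume.restrict D)) atTop (𝓝 0)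

/-! ### The elliptic operator -/

/-- Coefficients, smooth on `ℝᵈ`, of the operator
`𝒜u = -∑ aⁱʲ u_{xᵢxⱼ} + ∑ bⁱ u_{xᵢ} + c u`. -/
structure DiffOp (d : ℕ) where
  a : Fin d → Fin d → Space d → ℝ
  b : Fin d → Space d → ℝ
  c : Space d → ℝ
  smooth_a : ∀ i j, ContDiff ℝ ((⊤ : ℕ∞) : WithTop ℕ∞) (a i j)
  smooth_b : ∀ i, ContDiff ℝ ((⊤ : ℕ∞) : WithTop ℕ∞) (b i)
  smooth_c : ContDiff ℝ ((⊤ : ℕ∞) : WithTop ℕ∞) c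

/-- `A.Maps D u w`: `u` lies in the domain `H²(D) ∩ H¹₀(D)` of the operator, and `𝒜u = w`.
Here `p i`, `q i j` are the first and second weak derivatives of `u`. -/
def DiffOp.Maps {d : ℕ} (A : DiffOp d) (D : Set (Space d)) (u w : L2 D) : Prop :=
  MemH10 D u ∧
  ∃ (p : Fin d → L2 D) (q : Fin d → Fin d → L2 D),
    (∀ i, IsWeakPartial D i u (p i)) ∧
    (∀ i j, IsWeakPartial D j (p i) (q i j)) ∧
    ∀ᵐ x ∂(volume.restrict D),
      w x = -(∑ i, ∑ j, A.a i j x * q i j x) + (∑ i, A.b i x * p i x) + A.c x * u x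

/-- `𝒜`, with domain `H²(D) ∩ H¹₀(D)`, is symmetric, (uniformly) elliptic and positive definite. -/
structure DiffOp.IsSymmEllipticPosDef {d : ℕ} (A : DiffOp d) (D : Set (Space d)) : Prop where
  symm : ∀ u v Au Av : L2 D, A.Maps D u Au → A.Maps D v Av → inner ℝ Au v = inner ℝ u Av
  elliptic : ∃ θ : ℝ, 0 < θ ∧ ∀ x ∈ D, ∀ ξ : Space d,
    θ * ‖ξ‖ ^ 2 ≤ ∑ i, ∑ j, A.a i j x * ξ i * ξ j
  posDef : ∀ u Au : L2 D, A.Maps D u Au → u ≠ 0 → 0 < inner ℝ Au u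

/-- `(lam n, phi n)` is the eigensystem of `𝒜`: an orthonormal basis of `L²(D)` consisting of
eigenfunctions in `H²(D) ∩ H¹₀(D)`, listed in nondecreasing order of the eigenvalues. -/
structure DiffOp.IsEigensystem {d : ℕ} (A : DiffOp d) (D : Set (Space d))
    (lam : ℕ → ℝ) (phi : HilbertBasis ℕ ℝ (L2 D)) : Prop where
  mono : Monotone lam
  eigen : ∀ n, A.Maps D (phi n) (lam n • phi n)

/-! ### The Mittag-Leffler kernel -/

/-- The Mittag-Leffler function `E_{α,β}`, on the real line. -/
def mittagLeffler (α β z : ℝ) : ℝ := ∑' k : ℕ, z ^ k / Real.Gamma (k * α + β)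

/-- `s ↦ s^{α-1} E_{α,α}(-λ s^α)`. -/
def mlKernel (α lam s : ℝ) : ℝ := s ^ (α - 1) * mittagLeffler α α (-lam * s ^ α)

/-! ### The Wiener integral of a deterministic integrand -/

/-- A step function `∑ coefᵢ 1_{(leftᵢ, rightᵢ]}` on `(0, t]`. -/
structure StepFun (t : ℝ) where
  size : ℕ
  coef : Fin size → ℝ
  left : Fin size → ℝ
  right : Fin size → ℝ
  left_nonneg : ∀ i, 0 ≤ left i
  left_le_right : ∀ i, left i ≤ right i
  right_le : ∀ i, right i ≤ t

/-- The step function as a function of time. -/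
def StepFun.eval {t : ℝ} (s : StepFun t) (τ : ℝ) : ℝ :=
  ∑ i, (Ioc (s.left i) (s.right i)).indicator (fun _ => s.coef i) τ

/-- The elementary integral `∑ coefᵢ (W(rightᵢ) - W(leftᵢ))` of a step function. -/
def StepFun.integral {t : ℝ} {Ω : Type*} (s : StepFun t) (W : ℝ≥0 → Ω → ℝ) (ω : Ω) : ℝ :=
  ∑ i, s.coef i * (W (s.right i).toNNReal ω - W (s.left i).toNNReal ω)

/-- The random variable `X` is (a version of) the Wiener integral `∫₀ᵗ k(τ) dW(τ)` of
`k ∈ L²(0,t)`: the `L²(P)` limit of the elementary integrals of step functions converging to `k`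
in `L²(0,t)`. -/
def IsWienerIntegral {Ω : Type*} [MeasurableSpace Ω] (P : Measure Ω) (W : ℝ≥0 → Ω → ℝ)
    (t : ℝ) (k : ℝ → ℝ) (X : Ω → ℝ) : Prop :=
  MemLp k 2 (volume.restrict (Ioc 0 t)) ∧ MemLp X 2 P ∧
  ∃ s : ℕ → StepFun t,
    Tendsto (fun m => eLpNorm (fun τ => (s m).eval τ - k τ) 2 (volume.restrict (Ioc 0 t)))
      atTop (𝓝 0) ∧
    Tendsto (fun m => eLpNorm (fun ω => (s m).integral W ω - X ω) 2 P) atTop (𝓝 0)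

/-! ### The mild solution -/

/-- The deterministic coefficient
`I_{n,1}(t) = f_n ∫₀ᵗ (t-τ)^{α-1} E_{α,α}(-λ_n (t-τ)^α) h(τ) dτ`. -/
def detCoeff {d : ℕ} {D : Set (Space d)} (α : ℝ) (lam : ℕ → ℝ) (phi : HilbertBasis ℕ ℝ (L2 D))
    (f : L2 D) (h : ℝ → ℝ) (n : ℕ) (t : ℝ) : ℝ :=
  inner ℝ f (phi n) * ∫ τ in (0 : ℝ)..t, mlKernel α (lam n) (t - τ) * h τ

/-- The `L²(D)`-valued process `u` on `[0,T]` is (a jointly measurable version of) the mild solution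
`u(t) = ∑ₙ (I_{n,1}(t) + I_{n,2}(t)) φₙ`, with `I_{n,2}(t) = g_n J n t` and `J n t` the Wiener
integral `∫₀ᵗ (t-τ)^{α-1} E_{α,α}(-λ_n (t-τ)^α) dW(τ)`. The series converges in `L²(D)`, almost
surely for each time `t ∈ [0,T]`. -/
structure IsMildSolution {d : ℕ} {D : Set (Space d)} (α : ℝ) (lam : ℕ → ℝ)
    (phi : HilbertBasis ℕ ℝ (L2 D)) (T : ℝ) (f g : L2 D) (h : ℝ → ℝ)
    {Ω : Type*} [MeasurableSpace Ω] (P : Measure Ω) (W : ℝ≥0 → Ω → ℝ)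
    (u : ℝ → Ω → L2 D) : Prop where
  measurable : AEStronglyMeasurable (fun z : ℝ × Ω => u z.1 z.2)
    ((volume.restrict (Icc 0 T)).prod P)
  expansion : ∃ J : ℕ → ℝ → Ω → ℝ,
    (∀ n, ∀ t ∈ Icc 0 T,
      IsWienerIntegral P W t (fun τ => mlKernel α (lam n) (t - τ)) (J n t)) ∧
    ∀ t ∈ Icc 0 T, ∀ᵐ ω ∂P,
      HasSum (fun n => (detCoeff α lam phi f h n t + inner ℝ g (phi n) * J n t ω) • phi n) (u t ω)

/-- `𝔼‖u‖²_{L²(D×[0,T])}`, where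
`‖u(ω)‖_{L²(D×[0,T])}` is the norm of `t ↦ u(t, ω)` in `L²(0,T; L²(D)) = L²(D × [0,T])`. -/
def expectedSqNorm {d : ℕ} {D : Set (Space d)} (T : ℝ) {Ω : Type*} [MeasurableSpace Ω]
    (P : Measure Ω) (u : ℝ → Ω → L2 D) : ℝ≥0∞ :=
  ∫⁻ ω, (eLpNorm (fun t => u t ω) 2 (volume.restrict (Icc 0 T))) ^ 2 ∂P

end SFDE

end

/-!
By Parseval's identity in space and Tonelli's theorem, `𝔼‖u‖²` is the sum over `n` of the time
integrals of the second moments of `I_{n,1} + I_{n,2}`. Young's inequality bounds the deterministic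
part by the `L¹(0,T)` norm of the kernel `k(s) = s^{α-1} E_{α,α}(-λ_n s^α)` and the Itô isometry
bounds the stochastic part by its `L²(0,t)` norm.

Both norms are controlled through the Volterra equation
`k(t) = t^{α-1} / Γ(α) - λ_n / Γ(α) * ∫₀ᵗ (t-s)^{α-1} k(s) ds`, whose solution is shown to be
positive. Positivity gives `k(t) ≤ t^{α-1} / Γ(α)`, which is square integrable because `α > 1/2`,
and `‖k‖_{L¹(0,T)} = (1 - E_{α,1}(-λ_n T^α)) / λ_n ≤ 1 / λ_n`. Symmetry makes the smallest
eigenvalue the same for all eigensystems, so `1 / λ_n` is bounded in terms of the operator alone.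
-/

namespace SFDE

/-! ### The Mittag-Leffler function -/

section MittagLeffler

variable {α β p t : ℝ}

lemma rpow_mul_exp_neg_le_Gamma_add_one {R x : ℝ} (hR : 0 ≤ R) (hx : 0 ≤ x) :
    R ^ x * Real.exp (-R) ≤ Real.Gamma (x + 1) := by
  have hint := Real.GammaIntegral_convergent (s := x + 1) (by linarith)
  have hsub : Ioi R ⊆ Ioi (0 : ℝ) := Ioi_subset_Ioi hR
  rw [Real.Gamma_eq_integral (by linarith), ← integral_exp_neg_Ioi, ← integral_const_mul]
  calc ∫ u in Ioi R, R ^ x * Real.exp (-u)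
      ≤ ∫ u in Ioi R, Real.exp (-u) * u ^ (x + 1 - 1) := by
        refine setIntegral_mono_on ((integrableOn_exp_neg_Ioi R).const_mul _)
          (hint.mono_set hsub) measurableSet_Ioi fun u hu => ?_
        rw [add_sub_cancel_right, mul_comm]
        gcongr
        exact hu.le
    _ ≤ ∫ u in Ioi 0, Real.exp (-u) * u ^ (x + 1 - 1) := by
        refine setIntegral_mono_set hint ?_ hsub.eventuallyLE
        filter_upwards [self_mem_ae_restrict measurableSet_Ioi] with u (hu : 0 < u)
        positivity

lemma inv_Gamma_le {R x : ℝ} (hR : 0 < R) (hx : 0 < x) :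
    (Real.Gamma x)⁻¹ ≤ x * Real.exp R / R ^ x := by
  have h := rpow_mul_exp_neg_le_Gamma_add_one hR.le hx.le
  rw [Real.Gamma_add_one hx.ne', Real.exp_neg, ← div_eq_mul_inv, div_le_iff₀ (Real.exp_pos R)] at h
  rw [inv_le_iff_one_le_mul₀ (Real.Gamma_pos_of_pos hx), div_mul_eq_mul_div,
    one_le_div (by positivity)]
  linarith

lemma summable_mittagLeffler (hα : 0 < α) (hβ : 0 < β) (z : ℝ) :
    Summable fun k : ℕ => z ^ k / Real.Gamma (k * α + β) := by
  set B : ℝ := 2 * (|z| + 1) with hB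
  have hB0 : 0 < B := by positivity
  set R : ℝ := B ^ α⁻¹
  have hR : 0 < R := by positivity
  have hRB : R ^ α = B := Real.rpow_inv_rpow (by positivity) hα.ne'
  have hmajorant : Summable fun k : ℕ =>
      Real.exp R / R ^ β * (α * (k ^ 1 * (1 / 2 : ℝ) ^ k) + β * (1 / 2 : ℝ) ^ k) :=
    (((summable_pow_mul_geometric_of_norm_lt_one 1 (by norm_num)).mul_left α).add
      (summable_geometric_two.mul_left β)).mul_left _
  refine hmajorant.of_norm_bounded fun k => ?_
  have hx : 0 < k * α + β := by positivity
  have hpow : R ^ (k * α + β) = B ^ k * R ^ β := by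
    rw [Real.rpow_add hR, mul_comm (k : ℝ) α, Real.rpow_mul hR.le, hRB, Real.rpow_natCast]
  have hz : |z| ^ k ≤ (1 / 2 : ℝ) ^ k * B ^ k := by
    rw [← mul_pow]
    exact pow_le_pow_left₀ (abs_nonneg z) (by rw [hB]; linarith) k
  rw [norm_div, norm_pow, Real.norm_eq_abs, Real.norm_of_nonneg (Real.Gamma_pos_of_pos hx).le]
  calc |z| ^ k / Real.Gamma (k * α + β)
      ≤ ((1 / 2 : ℝ) ^ k * B ^ k) * ((k * α + β) * Real.exp R / R ^ (k * α + β)) := by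
        rw [div_eq_mul_inv]
        exact mul_le_mul hz (inv_Gamma_le hR hx)
          (inv_nonneg.2 (Real.Gamma_pos_of_pos hx).le) (by positivity)
    _ = Real.exp R / R ^ β * (α * (k ^ 1 * (1 / 2 : ℝ) ^ k) + β * (1 / 2 : ℝ) ^ k) := by
        rw [hpow]
        field_simp

lemma continuous_mittagLeffler (hα : 0 < α) (hβ : 0 < β) : Continuous (mittagLeffler α β) := by
  refine continuous_iff_continuousAt.2 fun z => ?_
  have h : ContinuousOn (mittagLeffler α β) (Metric.closedBall 0 (|z| + 1)) := by
    refine continuousOn_tsum (fun k => by fun_prop)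
      (summable_mittagLeffler hα hβ (|z| + 1)) fun k x hx => ?_
    have hG := Real.Gamma_pos_of_pos (show 0 < k * α + β by positivity)
    rw [norm_div, norm_pow, Real.norm_of_nonneg hG.le]
    have : ‖x‖ ≤ |z| + 1 := by simpa using hx
    gcongr
  exact h.continuousAt (Metric.closedBall_mem_nhds_of_mem (by simp))

lemma mittagLeffler_zero : mittagLeffler α β 0 = (Real.Gamma β)⁻¹ := by
  rw [mittagLeffler, tsum_eq_single 0 fun k hk => by simp [hk]]
  simp

lemma mittagLeffler_eq_add_mul (hα : 0 < α) (hβ : 0 < β) (z : ℝ) :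
    mittagLeffler α β z = (Real.Gamma β)⁻¹ + z * mittagLeffler α (β + α) z := by
  unfold mittagLeffler
  rw [(summable_mittagLeffler hα hβ z).tsum_eq_zero_add, ← tsum_mul_left]
  congr 1
  · simp
  · refine tsum_congr fun k => ?_
    rw [pow_succ', mul_div_assoc]
    congr 3
    push_cast
    ring

lemma integral_rpow_mul_sub_rpow {q : ℝ} (hq : 0 < q) (hp : 0 < p) (ht : 0 < t) :
    ∫ s in (0 : ℝ)..t, s ^ (q - 1) * (t - s) ^ (p - 1) = t ^ (q + p - 1) * beta q p := by
  apply Complex.ofReal_injective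
  have h := Complex.betaIntegral_scaled (q : ℂ) (p : ℂ) ht
  rw [Complex.betaIntegral_eq_Gamma_mul_div _ _ (by simpa) (by simpa)] at h
  simp only [beta, ← intervalIntegral.integral_ofReal, Complex.ofReal_mul, Complex.ofReal_div,
    Complex.ofReal_cpow ht.le, ← Complex.Gamma_ofReal, Complex.ofReal_add, Complex.ofReal_sub,
    Complex.ofReal_one]
  rw [← h]
  refine intervalIntegral.integral_congr fun s hs => ?_
  rw [uIcc_of_le ht.le] at hs
  simp [Complex.ofReal_cpow hs.1, Complex.ofReal_cpow (sub_nonneg.2 hs.2)]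

lemma intervalIntegrable_rpow_mul_sub_rpow {q : ℝ} (hq : 0 < q) (hp : 0 < p) (ht : 0 < t) :
    IntervalIntegrable (fun s => s ^ (q - 1) * (t - s) ^ (p - 1)) volume 0 t := by
  refine intervalIntegral.intervalIntegrable_of_integral_ne_zero (ne_of_gt ?_)
  rw [integral_rpow_mul_sub_rpow hq hp ht]
  have := beta_pos hq hp
  positivity

lemma sub_rpow_mul_mittagLeffler_term {s : ℝ} (hs : 0 < s) (z : ℝ) (k : ℕ) :
    (t - s) ^ (p - 1) * (s ^ (β - 1) * ((z * s ^ α) ^ k / Real.Gamma (k * α + β))) =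
      z ^ k / Real.Gamma (k * α + β) * (s ^ (k * α + β - 1) * (t - s) ^ (p - 1)) := by
  rw [show k * α + β - 1 = α * k + (β - 1) by ring, Real.rpow_add hs, Real.rpow_mul hs.le,
    Real.rpow_natCast, mul_pow]
  ring

lemma integral_sub_rpow_mul_mittagLeffler_term (hα : 0 ≤ α) (hβ : 0 < β) (hp : 0 < p) (ht : 0 < t)
    (z : ℝ) (k : ℕ) :
    ∫ s in Ioc 0 t, (t - s) ^ (p - 1) * (s ^ (β - 1) * ((z * s ^ α) ^ k / Real.Gamma (k * α + β)))
      = Real.Gamma p * t ^ (β + p - 1) *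
        ((z * t ^ α) ^ k / Real.Gamma (k * α + (β + p))) := by
  have hq : 0 < k * α + β := by positivity
  rw [setIntegral_congr_fun measurableSet_Ioc fun s hs =>
      sub_rpow_mul_mittagLeffler_term hs.1 z k, integral_const_mul,
    ← intervalIntegral.integral_of_le ht.le, integral_rpow_mul_sub_rpow hq hp ht, mul_pow, beta,
    show k * α + β + p - 1 = α * k + (β + p - 1) by ring, Real.rpow_add ht,
    Real.rpow_mul ht.le, Real.rpow_natCast, show k * α + β + p = k * α + (β + p) by ring]
  have := (Real.Gamma_pos_of_pos hq).ne'
  field_simp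

lemma integrableOn_sub_rpow_mul_mittagLeffler_term (hα : 0 ≤ α) (hβ : 0 < β) (hp : 0 < p)
    (ht : 0 < t) (z : ℝ) (k : ℕ) :
    IntegrableOn (fun s => (t - s) ^ (p - 1) *
      (s ^ (β - 1) * ((z * s ^ α) ^ k / Real.Gamma (k * α + β)))) (Ioc 0 t) := by
  have h := (intervalIntegrable_iff_integrableOn_Ioc_of_le ht.le).1
    (intervalIntegrable_rpow_mul_sub_rpow (q := k * α + β) (by positivity) hp ht)
  exact IntegrableOn.congr_fun (h.const_mul (z ^ k / Real.Gamma (k * α + β)))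
    (fun s hs => (sub_rpow_mul_mittagLeffler_term hs.1 z k).symm) measurableSet_Ioc

lemma intervalIntegrable_sub_rpow_mul_mittagLeffler (hα : 0 < α) (hβ : 0 < β) (hp : 0 < p)
    (ht : 0 < t) (z : ℝ) :
    IntervalIntegrable (fun s => (t - s) ^ (p - 1) * (s ^ (β - 1) *
      mittagLeffler α β (z * s ^ α))) volume 0 t := by
  have hc : Continuous fun s : ℝ => mittagLeffler α β (z * s ^ α) :=
    (continuous_mittagLeffler hα hβ).comp
      (continuous_const.mul (Real.continuous_rpow_const hα.le))
  refine ((intervalIntegrable_rpow_mul_sub_rpow hβ hp ht).mul_continuousOn hc.continuousOn).congr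
    fun s _ => ?_
  ring

-- The Riemann–Liouville integral of order `p` raises the second parameter by `p`.
lemma integral_sub_rpow_mul_mittagLeffler (hα : 0 < α) (hβ : 0 < β) (hp : 0 < p) (ht : 0 < t)
    (z : ℝ) :
    ∫ s in (0 : ℝ)..t, (t - s) ^ (p - 1) * (s ^ (β - 1) * mittagLeffler α β (z * s ^ α)) =
      Real.Gamma p * (t ^ (β + p - 1) * mittagLeffler α (β + p) (z * t ^ α)) := by
  set F : ℝ → ℕ → ℝ → ℝ := fun z k s => (t - s) ^ (p - 1) *
    (s ^ (β - 1) * ((z * s ^ α) ^ k / Real.Gamma (k * α + β))) with hF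
  have hnorm : ∀ k, ∫ s in Ioc 0 t, ‖F z k s‖ = ∫ s in Ioc 0 t, F |z| k s := fun k => by
    refine setIntegral_congr_fun measurableSet_Ioc fun s hs => ?_
    have hs0 : 0 ≤ s := hs.1.le
    have hts : 0 ≤ t - s := sub_nonneg.2 hs.2
    have hG := Real.Gamma_pos_of_pos (show 0 < k * α + β by positivity)
    simp only [hF, norm_mul, norm_div, norm_pow, Real.norm_eq_abs, Real.abs_rpow_of_nonneg hts,
      Real.abs_rpow_of_nonneg hs0, abs_of_nonneg hs0, abs_of_nonneg hts, abs_of_pos hG]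
  have hsummable : Summable fun k => ∫ s in Ioc 0 t, ‖F z k s‖ := by
    simp_rw [hnorm, hF, integral_sub_rpow_mul_mittagLeffler_term hα.le hβ hp ht]
    exact (summable_mittagLeffler hα (by positivity) _).mul_left _
  have hsum := hasSum_integral_of_summable_integral_norm
    (integrableOn_sub_rpow_mul_mittagLeffler_term hα.le hβ hp ht z) hsummable
  calc ∫ s in (0 : ℝ)..t, (t - s) ^ (p - 1) * (s ^ (β - 1) * mittagLeffler α β (z * s ^ α))
      = ∫ s in Ioc 0 t, ∑' k, F z k s := by
        rw [intervalIntegral.integral_of_le ht.le]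
        simp only [hF, tsum_mul_left, mittagLeffler]
    _ = ∑' k, ∫ s in Ioc 0 t, F z k s := hsum.tsum_eq.symm
    _ = Real.Gamma p * (t ^ (β + p - 1) * mittagLeffler α (β + p) (z * t ^ α)) := by
        simp only [hF, integral_sub_rpow_mul_mittagLeffler_term hα.le hβ hp ht, tsum_mul_left,
          mittagLeffler, mul_assoc]

end MittagLeffler

/-! ### Positivity for Abel–Volterra equations -/

lemma pos_of_eventually_of_forall_pos_lt {r : ℝ → ℝ} {a : ℝ} (hr : ContinuousOn r (Ioi a))
    (hnear : ∀ᶠ s in 𝓝[>] a, 0 < r s)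
    (hstep : ∀ t > a, (∀ s ∈ Ioo a t, 0 < r s) → 0 < r t) {t : ℝ} (ht : a < t) : 0 < r t := by
  by_contra! hneg
  obtain ⟨ε, hε, hpos⟩ := mem_nhdsGT_iff_exists_Ioo_subset.1 hnear
  have hrε : ContinuousOn r (Icc ε t) := hr.mono fun s hs => hε.trans_le hs.1
  have hZ : IsCompact (Icc ε t ∩ r ⁻¹' Iic 0) :=
    isCompact_Icc.of_isClosed_subset (hrε.preimage_isClosed_of_isClosed isClosed_Icc isClosed_Iic)
      inter_subset_left
  have hεt : ε ≤ t := not_lt.1 fun h => (hpos ⟨ht, h⟩).not_ge hneg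
  obtain ⟨t₀, ⟨⟨hεt₀, ht₀t⟩, hrt₀⟩, hleast⟩ := hZ.exists_isLeast ⟨t, ⟨hεt, le_rfl⟩, hneg⟩
  refine (hstep t₀ (hε.trans_le hεt₀) fun s hs => ?_).not_ge hrt₀
  by_contra! hrs
  have hεs : ε ≤ s := not_lt.1 fun h => (hpos ⟨hs.1, h⟩).not_ge hrs
  exact hs.2.not_ge (hleast ⟨⟨hεs, hs.2.le.trans ht₀t⟩, hrs⟩)

/-- `r` is a solution on `(0, ∞)` of the Volterra equation `r + κ a ∗ r = c a` with the Abel kernel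
`a(t) = t^(α-1)`; for `c = 1 / Γ(α)` and `κ = lam / Γ(α)` it is `mlKernel α lam`. -/
structure IsAbelVolterraSolution (α κ c : ℝ) (r : ℝ → ℝ) : Prop where
  continuousOn : ContinuousOn r (Ioi 0)
  intervalIntegrable {t : ℝ} (ht : 0 < t) :
    IntervalIntegrable (fun s => (t - s) ^ (α - 1) * r s) volume 0 t
  equation {t : ℝ} (ht : 0 < t) :
    r t + κ * ∫ s in (0 : ℝ)..t, (t - s) ^ (α - 1) * r s = c * t ^ (α - 1)

section Abel

variable {α : ℝ}

lemma integral_sub_rpow (hα : 0 < α) (a b : ℝ) :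
    ∫ s in a..b, (b - s) ^ (α - 1) = (b - a) ^ α / α := by
  rw [intervalIntegral.integral_comp_sub_left (fun x => x ^ (α - 1)), sub_self,
    integral_rpow (Or.inl (by linarith)), sub_add_cancel, Real.zero_rpow hα.ne', sub_zero]

lemma intervalIntegrable_sub_rpow (hα : 0 < α) (a b : ℝ) :
    IntervalIntegrable (fun s : ℝ => (b - s) ^ (α - 1)) volume a b := by
  simpa using (intervalIntegral.intervalIntegrable_rpow' (a := b - a) (b := 0)
    (show -1 < α - 1 by linarith)).comp_sub_left b

namespace IsAbelVolterraSolution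

variable {κ c t t₀ : ℝ} {r : ℝ → ℝ}

lemma intervalIntegrable_subinterval (hr : IsAbelVolterraSolution α κ c r) {a b : ℝ} (ha : 0 ≤ a)
    (hat₀ : a ≤ t₀) (hb : 0 ≤ b) (hbt₀ : b ≤ t₀) (ht₀ : 0 < t₀) :
    IntervalIntegrable (fun s => (t₀ - s) ^ (α - 1) * r s) volume a b :=
  (hr.intervalIntegrable ht₀).mono_set <| by
    rw [uIcc_of_le ht₀.le]
    exact uIcc_subset_Icc ⟨ha, hat₀⟩ ⟨hb, hbt₀⟩

-- For `s < t < t₀` one has `(t₀ - s)^(α-1) ≤ (t₀/t)^(α-1) (t - s)^(α-1)`.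
lemma integral_le_rpow_mul_integral (hr : IsAbelVolterraSolution α κ c r) (hα₁ : α ≤ 1)
    (ht : 0 < t) (htt₀ : t < t₀) (hnn : ∀ s ∈ Ioo 0 t, 0 ≤ r s) :
    ∫ s in (0 : ℝ)..t, (t₀ - s) ^ (α - 1) * r s ≤
      (t₀ / t) ^ (α - 1) * ∫ s in (0 : ℝ)..t, (t - s) ^ (α - 1) * r s := by
  have ht₀ : 0 < t₀ := ht.trans htt₀
  rw [← intervalIntegral.integral_const_mul]
  refine intervalIntegral.integral_mono_on_of_le_Ioo ht.le
    (hr.intervalIntegrable_subinterval le_rfl ht₀.le ht.le htt₀.le ht₀)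
    ((hr.intervalIntegrable ht).const_mul _) fun s hs => ?_
  have hts : 0 < t - s := sub_pos.2 hs.2
  rw [← mul_assoc, ← Real.mul_rpow (by positivity) hts.le]
  refine mul_le_mul_of_nonneg_right ?_ (hnn s hs)
  refine Real.rpow_le_rpow_of_nonpos (by positivity) ?_ (by linarith)
  rw [div_mul_eq_mul_div, div_le_iff₀ ht]
  nlinarith [hs.1]

lemma rpow_mul_le_add_integral (hr : IsAbelVolterraSolution α κ c r) (hα₁ : α ≤ 1) (hκ : 0 ≤ κ)
    (ht : 0 < t) (htt₀ : t < t₀) (hnn : ∀ s ∈ Ioo 0 t, 0 ≤ r s) :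
    (t₀ / t) ^ (α - 1) * r t ≤ r t₀ + κ * ∫ s in t..t₀, (t₀ - s) ^ (α - 1) * r s := by
  have ht₀ : 0 < t₀ := ht.trans htt₀
  have hrpow : (t₀ / t) ^ (α - 1) * t ^ (α - 1) = t₀ ^ (α - 1) := by
    rw [← Real.mul_rpow (by positivity) ht.le, div_mul_cancel₀ _ ht.ne']
  have hsplit := intervalIntegral.integral_add_adjacent_intervals
    (hr.intervalIntegrable_subinterval le_rfl ht₀.le ht.le htt₀.le ht₀)
    (hr.intervalIntegrable_subinterval ht.le htt₀.le ht₀.le le_rfl ht₀)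
  have hcompare := mul_le_mul_of_nonneg_left (hr.integral_le_rpow_mul_integral hα₁ ht htt₀ hnn) hκ
  have heq := hr.equation ht₀
  rw [← hrpow, ← mul_assoc, mul_comm c, mul_assoc, ← hr.equation ht, ← hsplit] at heq
  linarith

lemma integral_le_mul_rpow (hr : IsAbelVolterraSolution α κ c r) (hα : 0 < α) (ht : 0 < t)
    (htt₀ : t ≤ t₀) {M : ℝ} (hM : ∀ s ∈ Icc t t₀, r s ≤ M) :
    ∫ s in t..t₀, (t₀ - s) ^ (α - 1) * r s ≤ M * ((t₀ - t) ^ α / α) := by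
  have ht₀ : 0 < t₀ := ht.trans_le htt₀
  rw [← integral_sub_rpow hα, mul_comm, ← intervalIntegral.integral_mul_const]
  refine intervalIntegral.integral_mono_on htt₀
    (hr.intervalIntegrable_subinterval ht.le htt₀ ht₀.le le_rfl ht₀)
    ((intervalIntegrable_sub_rpow hα t t₀).mul_const _) fun s hs => ?_
  exact mul_le_mul_of_nonneg_left (hM s hs) (Real.rpow_nonneg (sub_nonneg.2 hs.2) _)

-- If `t₀` were a first zero, compare it with a maximum point of `r` on `[t₀ - δ, t₀]`: the memory
-- term of so short an interval cannot pull the solution from this maximum down to `0`.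
lemma pos_of_forall_pos_lt (hr : IsAbelVolterraSolution α κ c r) (hα : 0 < α) (hα₁ : α ≤ 1)
    (hκ : 0 ≤ κ) (ht₀ : 0 < t₀) (hpos : ∀ s ∈ Ioo 0 t₀, 0 < r s) : 0 < r t₀ := by
  by_contra! hrt₀
  obtain ⟨δ, ⟨hδ₀, hδt₀⟩, hδ⟩ : ∃ δ ∈ Ioo 0 (t₀ / 2), κ * (δ ^ α / α) < 1 / 2 := by
    have hlim : Tendsto (fun δ : ℝ => κ * (δ ^ α / α)) (𝓝[>] 0) (𝓝 0) := by
      have hc : Continuous fun δ : ℝ => κ * (δ ^ α / α) :=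
        continuous_const.mul ((Real.continuous_rpow_const hα.le).div_const α)
      simpa [Real.zero_rpow hα.ne'] using (hc.tendsto 0).mono_left nhdsWithin_le_nhds
    have hIoo : ∀ᶠ δ in 𝓝[>] 0, δ ∈ Ioo 0 (t₀ / 2) := Ioo_mem_nhdsGT (half_pos ht₀)
    exact (hIoo.and (hlim.eventually_lt_const (by norm_num))).exists
  obtain ⟨t, ⟨hδt, htt₀⟩, hmax⟩ := isCompact_Icc.exists_isMaxOn
    (nonempty_Icc.2 (show t₀ - δ ≤ t₀ by linarith))
    (hr.continuousOn.mono fun s hs => show 0 < s by linarith [hs.1])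
  have ht : 0 < t := by linarith
  have hrt : 0 < r t := (hpos (t₀ - δ) ⟨by linarith, by linarith⟩).trans_le
    (hmax (left_mem_Icc.2 (by linarith)))
  replace htt₀ : t < t₀ := lt_of_le_of_ne htt₀ fun h => hrt.not_ge (h ▸ hrt₀)
  have hupper := hr.integral_le_mul_rpow hα ht htt₀.le fun s hs => hmax ⟨hδt.trans hs.1, hs.2⟩
  have hcompare := hr.rpow_mul_le_add_integral hα₁ hκ ht htt₀ fun s hs =>
    (hpos s ⟨hs.1, hs.2.trans htt₀⟩).le
  have hratio : 1 / 2 ≤ (t₀ / t) ^ (α - 1) := by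
    calc (1 / 2 : ℝ) = 2 ^ (-1 : ℝ) := by rw [Real.rpow_neg_one]; norm_num
      _ ≤ 2 ^ (α - 1) := Real.rpow_le_rpow_of_exponent_le (by norm_num) (by linarith)
      _ ≤ (t₀ / t) ^ (α - 1) := by
          refine Real.rpow_le_rpow_of_nonpos (by positivity) ?_ (by linarith)
          rw [div_le_iff₀ ht]
          linarith
  have hsmall : κ * ((t₀ - t) ^ α / α) < 1 / 2 := by
    refine lt_of_le_of_lt ?_ hδ
    gcongr
    linarith
  nlinarith

lemma pos (hr : IsAbelVolterraSolution α κ c r) (hα : 0 < α) (hα₁ : α ≤ 1) (hκ : 0 ≤ κ)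
    (hnear : ∀ᶠ s in 𝓝[>] 0, 0 < r s) (ht : 0 < t) : 0 < r t :=
  pos_of_eventually_of_forall_pos_lt hr.continuousOn hnear
    (fun _ => hr.pos_of_forall_pos_lt hα hα₁ hκ) ht

end IsAbelVolterraSolution

end Abel

/-! ### The Mittag-Leffler kernel -/

section Kernel

variable {α lam t : ℝ}

lemma continuousOn_mlKernel (hα : 0 < α) : ContinuousOn (mlKernel α lam) (Ioi 0) := by
  refine ContinuousOn.mul
    (fun s hs => (Real.continuousAt_rpow_const s _ (Or.inl (ne_of_gt hs))).continuousWithinAt) ?_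
  exact ((continuous_mittagLeffler hα hα).comp
    (continuous_const.mul (Real.continuous_rpow_const hα.le))).continuousOn

lemma measurable_mlKernel (hα : 0 < α) : Measurable (mlKernel α lam) := by
  unfold mlKernel
  have := (continuous_mittagLeffler hα hα).measurable
  fun_prop

lemma isAbelVolterraSolution_mlKernel (hα : 0 < α) :
    IsAbelVolterraSolution α (lam / Real.Gamma α) (Real.Gamma α)⁻¹ (mlKernel α lam) where
  continuousOn := continuousOn_mlKernel hα
  intervalIntegrable ht := intervalIntegrable_sub_rpow_mul_mittagLeffler hα hα hα ht _
  equation {t} ht := by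
    have hG := (Real.Gamma_pos_of_pos hα).ne'
    unfold mlKernel
    rw [integral_sub_rpow_mul_mittagLeffler hα hα hα ht, mittagLeffler_eq_add_mul hα hα,
      show α + α - 1 = α + (α - 1) by ring, Real.rpow_add ht]
    field_simp
    ring

lemma eventually_mlKernel_pos (hα : 0 < α) : ∀ᶠ s in 𝓝[>] 0, 0 < mlKernel α lam s := by
  have hc : Continuous fun s : ℝ => mittagLeffler α α (-lam * s ^ α) :=
    (continuous_mittagLeffler hα hα).comp
      (continuous_const.mul (Real.continuous_rpow_const hα.le))
  have h0 : 0 < mittagLeffler α α (-lam * (0 : ℝ) ^ α) := by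
    rw [Real.zero_rpow hα.ne', mul_zero, mittagLeffler_zero]
    exact inv_pos.2 (Real.Gamma_pos_of_pos hα)
  filter_upwards [nhdsWithin_le_nhds ((hc.tendsto 0).eventually_const_lt h0), self_mem_nhdsWithin]
    with s hE hs
  exact mul_pos (Real.rpow_pos_of_pos hs _) hE

lemma mlKernel_pos (hα : 0 < α) (hα₁ : α ≤ 1) (hlam : 0 ≤ lam) (ht : 0 < t) :
    0 < mlKernel α lam t :=
  (isAbelVolterraSolution_mlKernel hα).pos hα hα₁
    (div_nonneg hlam (Real.Gamma_pos_of_pos hα).le) (eventually_mlKernel_pos hα) ht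

lemma integral_sub_rpow_mul_mlKernel_nonneg (hα : 0 < α) (hα₁ : α ≤ 1) (hlam : 0 ≤ lam)
    (ht : 0 ≤ t) (p : ℝ) : 0 ≤ ∫ s in (0 : ℝ)..t, (t - s) ^ p * mlKernel α lam s := by
  rw [intervalIntegral.integral_of_le ht]
  exact setIntegral_nonneg measurableSet_Ioc fun s hs =>
    mul_nonneg (Real.rpow_nonneg (sub_nonneg.2 hs.2) _) (mlKernel_pos hα hα₁ hlam hs.1).le

lemma mlKernel_le (hα : 0 < α) (hα₁ : α ≤ 1) (hlam : 0 ≤ lam) (ht : 0 < t) :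
    mlKernel α lam t ≤ (Real.Gamma α)⁻¹ * t ^ (α - 1) := by
  rw [← (isAbelVolterraSolution_mlKernel (lam := lam) hα).equation ht]
  exact le_add_of_nonneg_right (mul_nonneg (div_nonneg hlam (Real.Gamma_pos_of_pos hα).le)
    (integral_sub_rpow_mul_mlKernel_nonneg hα hα₁ hlam ht.le _))

lemma intervalIntegrable_mlKernel (hα : 0 < α) (ht : 0 < t) :
    IntervalIntegrable (mlKernel α lam) volume 0 t := by
  unfold mlKernel
  simpa using intervalIntegrable_sub_rpow_mul_mittagLeffler hα hα one_pos ht (-lam)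

lemma mittagLeffler_one_nonneg (hα : 0 < α) (hα₁ : α ≤ 1) (hlam : 0 ≤ lam) (ht : 0 < t) :
    0 ≤ mittagLeffler α 1 (-lam * t ^ α) := by
  obtain rfl | hα₁' := hα₁.eq_or_lt
  · simpa [mlKernel] using (mlKernel_pos one_pos le_rfl hlam ht).le
  · have hint := integral_sub_rpow_mul_mlKernel_nonneg hα hα₁ hlam ht.le (1 - α - 1)
    unfold mlKernel at hint
    rw [integral_sub_rpow_mul_mittagLeffler hα hα (sub_pos.2 hα₁') ht, add_sub_cancel, sub_self,
      Real.rpow_zero, one_mul] at hint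
    exact nonneg_of_mul_nonneg_right hint (Real.Gamma_pos_of_pos (sub_pos.2 hα₁'))

lemma integral_mlKernel_le (hα : 0 < α) (hα₁ : α ≤ 1) (hlam : 0 < lam) (ht : 0 < t) :
    ∫ s in (0 : ℝ)..t, mlKernel α lam s ≤ lam⁻¹ := by
  have hvalue := integral_sub_rpow_mul_mittagLeffler hα hα one_pos ht (-lam)
  simp only [sub_self, Real.rpow_zero, one_mul, Real.Gamma_one, add_sub_cancel_right] at hvalue
  have hE := mittagLeffler_one_nonneg hα hα₁ hlam.le ht
  rw [mittagLeffler_eq_add_mul hα one_pos, Real.Gamma_one] at hE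
  unfold mlKernel
  rw [hvalue, ← one_div, le_div_iff₀ hlam, add_comm α 1]
  linarith

end Kernel

/-! ### The Wiener integral -/

section Lp

variable {X Y : Type*} {mX : MeasurableSpace X} {mY : MeasurableSpace Y} {μ : Measure X}
  {ν : Measure Y}

lemma eLpNorm_two_eq_of_integral_sq_eq {f : X → ℝ} {g : Y → ℝ} (hf : MemLp f 2 μ)
    (hg : MemLp g 2 ν) (h : ∫ x, f x ^ 2 ∂μ = ∫ y, g y ^ 2 ∂ν) :
    eLpNorm f 2 μ = eLpNorm g 2 ν := by
  rw [hf.eLpNorm_eq_integral_rpow_norm two_ne_zero (by simp),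
    hg.eLpNorm_eq_integral_rpow_norm two_ne_zero (by simp)]
  simp [h]

lemma integral_sum_sq {ι : Type*} [Fintype ι] (c : ι → ℝ) {f : ι → X → ℝ}
    (hf : ∀ i, MemLp (f i) 2 μ) :
    ∫ x, (∑ i, c i * f i x) ^ 2 ∂μ = ∑ i, ∑ j, c i * c j * ∫ x, f i x * f j x ∂μ := by
  have hint : ∀ i j, Integrable (fun x => c i * f i x * (c j * f j x)) μ := fun i j =>
    ((hf i).const_mul _).integrable_mul ((hf j).const_mul _)
  simp_rw [sq, Finset.sum_mul_sum]
  rw [integral_finsetSum _ fun i _ => integrable_finsetSum _ fun j _ => hint i j]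
  simp_rw [integral_finsetSum _ fun j _ => hint _ j, mul_mul_mul_comm, integral_const_mul]

lemma tendsto_eLpNorm_of_tendsto_eLpNorm_sub {E ι : Type*} [NormedAddCommGroup E] {p : ℝ≥0∞}
    [Fact (1 ≤ p)] {l : Filter ι} {f : ι → X → E} {F : X → E} (hf : ∀ i, MemLp (f i) p μ)
    (hF : MemLp F p μ) (hfF : Tendsto (fun i => eLpNorm (f i - F) p μ) l (𝓝 0)) :
    Tendsto (fun i => eLpNorm (f i) p μ) l (𝓝 (eLpNorm F p μ)) := by
  simpa only [Lp.enorm_toLp] using ((Lp.tendsto_Lp_iff_tendsto_eLpNorm'' f hf F hF).2 hfF).enorm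

lemma integral_indicator_one_mul_indicator_one {s t : Set X} (hs : MeasurableSet s)
    (ht : MeasurableSet t) :
    ∫ x, s.indicator 1 x * t.indicator 1 x ∂μ = μ.real (s ∩ t) := by
  simp_rw [← inter_indicator_mul (1 : X → ℝ) 1, Pi.one_apply, mul_one]
  exact integral_indicator_one (hs.inter ht)

end Lp

section WienerIntegral

variable {Ω : Type*} {mΩ : MeasurableSpace Ω} {P : Measure Ω} {W : ℝ≥0 → Ω → ℝ}

section Brownian

lemma memLp_increment (hW : IsPreBrownianReal W P) (a b : ℝ≥0) :
    MemLp (fun ω => W b ω - W a ω) 2 P :=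
  (hW.isGaussianProcess.hasGaussianLaw_eval b).memLp_two.sub
    (hW.isGaussianProcess.hasGaussianLaw_eval a).memLp_two

lemma integral_brownian_mul (hW : IsPreBrownianReal W P) (s t : ℝ≥0) :
    ∫ ω, W s ω * W t ω ∂P = min s t := by
  have hW' := hW.isGaussianProcess.hasGaussianLaw_eval
  have := (hW' 0).isProbabilityMeasure
  have h := covariance_eq_sub (hW' s).memLp_two (hW' t).memLp_two
  rw [hW.covariance_eval, hW.integral_eval, zero_mul, sub_zero] at h
  exact h.symm

lemma integral_increment_mul_increment (hW : IsPreBrownianReal W P) {a b c d : ℝ≥0}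
    (hab : a ≤ b) (hcd : c ≤ d) :
    ∫ ω, (W b ω - W a ω) * (W d ω - W c ω) ∂P =
      volume.real (Ioc (a : ℝ) b ∩ Ioc (c : ℝ) d) := by
  have hW' := hW.isGaussianProcess.hasGaussianLaw_eval
  have hint : ∀ s t, Integrable (fun ω => W s ω * W t ω) P := fun s t =>
    (hW' s).memLp_two.integrable_mul (hW' t).memLp_two
  have hint_sub : ∀ s t u, Integrable (fun ω => W s ω * W t ω - W s ω * W u ω) P :=
    fun s t u => (hint s t).sub (hint s u)
  simp_rw [sub_mul, mul_sub]
  rw [integral_sub (hint_sub _ _ _) (hint_sub _ _ _), integral_sub (hint _ _) (hint _ _),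
    integral_sub (hint _ _) (hint _ _)]
  simp only [integral_brownian_mul hW, Ioc_inter_Ioc, Real.volume_real_Ioc, NNReal.coe_min]
  have : (a : ℝ) ≤ b := hab
  have : (c : ℝ) ≤ d := hcd
  grind

end Brownian

namespace StepFun

variable {t t' : ℝ}

/-- The difference of two step functions, living on the longer of their two intervals. -/
def sub (s : StepFun t) (s' : StepFun t') : StepFun (max t t') where
  size := s.size + s'.size
  coef := Fin.append s.coef fun i => -s'.coef i
  left := Fin.append s.left s'.left
  right := Fin.append s.right s'.right
  left_nonneg := Fin.addCases (by simp [s.left_nonneg]) (by simp [s'.left_nonneg])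
  left_le_right := Fin.addCases (by simp [s.left_le_right]) (by simp [s'.left_le_right])
  right_le := Fin.addCases (by simp [s.right_le]) (by simp [s'.right_le])

lemma eval_eq_sum_mul (s : StepFun t) :
    s.eval = fun τ => ∑ i, s.coef i * (Ioc (s.left i) (s.right i)).indicator 1 τ := by
  ext τ
  simp [eval, indicator_apply]

lemma eval_sub (s : StepFun t) (s' : StepFun t') : (s.sub s').eval = s.eval - s'.eval := by
  ext τ
  simp only [eval_eq_sum_mul, Pi.sub_apply]
  exact (Fin.sum_univ_add _).trans (by simp [sub, sub_eq_add_neg])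

lemma integral_sub (s : StepFun t) (s' : StepFun t') :
    (s.sub s').integral W = s.integral W - s'.integral W := by
  ext ω
  simp only [StepFun.integral, Pi.sub_apply]
  exact (Fin.sum_univ_add _).trans (by simp [sub, sub_eq_add_neg])

lemma indicator_eval (s : StepFun t) : (Ioc 0 t).indicator s.eval = s.eval := by
  refine indicator_eq_self.2 fun x hx => ?_
  obtain ⟨i, -, hi⟩ := Finset.exists_ne_zero_of_sum_ne_zero hx
  have hmem := mem_of_indicator_ne_zero hi
  exact ⟨(s.left_nonneg i).trans_lt hmem.1, hmem.2.trans (s.right_le i)⟩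

lemma memLp_eval (s : StepFun t) {p : ℝ≥0∞} {μ : Measure ℝ} [IsLocallyFiniteMeasure μ] :
    MemLp s.eval p μ :=
  memLp_finsetSum _ fun _ _ =>
    memLp_indicator_const p measurableSet_Ioc _ (Or.inr measure_Ioc_lt_top.ne)

lemma memLp_integral (s : StepFun t) (hW : IsPreBrownianReal W P) : MemLp (s.integral W) 2 P :=
  memLp_finsetSum _ fun _ _ => (memLp_increment hW _ _).const_mul _

lemma integral_eval_sq (s : StepFun t) :
    ∫ τ, s.eval τ ^ 2 = ∑ i, ∑ j, s.coef i * s.coef j *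
      volume.real (Ioc (s.left i) (s.right i) ∩ Ioc (s.left j) (s.right j)) := by
  simp_rw [eval_eq_sum_mul]
  have hind : ∀ i, MemLp ((Ioc (s.left i) (s.right i)).indicator (1 : ℝ → ℝ)) 2 := fun i =>
    memLp_indicator_const 2 measurableSet_Ioc 1 (Or.inr measure_Ioc_lt_top.ne)
  rw [integral_sum_sq _ hind]
  simp_rw [integral_indicator_one_mul_indicator_one measurableSet_Ioc measurableSet_Ioc]

lemma integral_integral_sq (s : StepFun t) (hW : IsPreBrownianReal W P) :
    ∫ ω, s.integral W ω ^ 2 ∂P = ∑ i, ∑ j, s.coef i * s.coef j *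
      volume.real (Ioc (s.left i) (s.right i) ∩ Ioc (s.left j) (s.right j)) := by
  unfold StepFun.integral
  have hle i : (s.left i).toNNReal ≤ (s.right i).toNNReal :=
    Real.toNNReal_le_toNNReal (s.left_le_right i)
  have hright i : ((s.right i).toNNReal : ℝ) = s.right i :=
    Real.coe_toNNReal _ ((s.left_nonneg i).trans (s.left_le_right i))
  have hleft i : ((s.left i).toNNReal : ℝ) = s.left i := Real.coe_toNNReal _ (s.left_nonneg i)
  rw [integral_sum_sq _ fun i => memLp_increment hW _ _]
  simp_rw [integral_increment_mul_increment hW (hle _) (hle _), hleft, hright]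

lemma eLpNorm_integral_eq_volume (s : StepFun t) (hW : IsPreBrownianReal W P) :
    eLpNorm (s.integral W) 2 P = eLpNorm s.eval 2 volume :=
  eLpNorm_two_eq_of_integral_sq_eq (s.memLp_integral hW) s.memLp_eval
    ((s.integral_integral_sq hW).trans s.integral_eval_sq.symm)

lemma eLpNorm_integral (s : StepFun t) (hW : IsPreBrownianReal W P) :
    eLpNorm (s.integral W) 2 P = eLpNorm s.eval 2 (volume.restrict (Ioc 0 t)) := by
  rw [s.eLpNorm_integral_eq_volume hW, ← eLpNorm_indicator_eq_eLpNorm_restrict measurableSet_Ioc,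
    s.indicator_eval]

/-- The step function on `(0, t]` that interpolates `g` at the right endpoints of the uniform
partition into `N` intervals. -/
noncomputable def interpolate (g : ℝ → ℝ) (ht : 0 ≤ t) (N : ℕ) : StepFun t where
  size := N
  coef i := g (t * (i + 1) / N)
  left i := t * i / N
  right i := t * (i + 1) / N
  left_nonneg i := by positivity
  left_le_right i := by gcongr; linarith
  right_le i := by
    have hN : (0 : ℝ) < N := by exact_mod_cast i.pos
    have hi : ((i : ℕ) : ℝ) + 1 ≤ N := by exact_mod_cast i.2
    rw [div_le_iff₀ hN]
    gcongr

lemma mem_Ioc_div_iff_ceil_eq {x : ℝ} (ht : 0 < t) {N : ℕ} (hN : 0 < N) (i : ℕ) :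
    x ∈ Ioc (t * i / N) (t * (i + 1) / N) ↔ ⌈x * N / t⌉₊ = i + 1 := by
  have hN' : (0 : ℝ) < N := by exact_mod_cast hN
  rw [Nat.ceil_eq_iff i.add_one_ne_zero, Nat.add_sub_cancel, mem_Ioc, div_lt_iff₀ hN',
    le_div_iff₀ hN', lt_div_iff₀ ht, div_le_iff₀ ht, Nat.cast_add_one, mul_comm t, mul_comm t]

lemma eval_interpolate (g : ℝ → ℝ) {N : ℕ} (hN : 0 < N) {x : ℝ} (hx : x ∈ Ioc 0 t) :
    (interpolate g (hx.1.le.trans hx.2) N).eval x = g (t * ⌈x * N / t⌉₊ / N) := by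
  have ht : 0 < t := hx.1.trans_le hx.2
  have hN' : (0 : ℝ) < N := by exact_mod_cast hN
  obtain ⟨j, hj⟩ : ∃ j, ⌈x * N / t⌉₊ = j + 1 :=
    Nat.exists_eq_succ_of_ne_zero (Nat.ceil_pos.2 (div_pos (mul_pos hx.1 hN') ht)).ne'
  have hjN : j < N := by
    rw [← Nat.succ_le_iff, Nat.succ_eq_add_one, ← hj, Nat.ceil_le, div_le_iff₀ ht, mul_comm]
    gcongr
    exact hx.2
  have hmem (i : Fin N) : x ∈ Ioc (t * i / N) (t * (i + 1) / N) ↔ i = ⟨j, hjN⟩ := by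
    rw [mem_Ioc_div_iff_ceil_eq ht hN, hj, Nat.add_right_cancel_iff, Fin.ext_iff, eq_comm]
  change ∑ i : Fin N, (Ioc (t * i / N) (t * (i + 1) / N)).indicator
    (fun _ => g (t * (i + 1) / N)) x = _
  simp [indicator_apply, hmem, hj, -mem_Ioc]

lemma abs_mul_ceil_div_sub_le {x : ℝ} (ht : 0 < t) (hx : 0 ≤ x) {N : ℕ} (hN : 0 < N) :
    |t * ⌈x * N / t⌉₊ / N - x| ≤ t / N := by
  have : (0 : ℝ) < N := by exact_mod_cast hN
  have hlower : x * N / t ≤ ⌈x * N / t⌉₊ := Nat.le_ceil _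
  have hupper : (⌈x * N / t⌉₊ : ℝ) < x * N / t + 1 := Nat.ceil_lt_add_one (by positivity)
  rw [show t * ⌈x * N / t⌉₊ / N - x = t / N * (⌈x * N / t⌉₊ - x * N / t) by field_simp,
    abs_of_nonneg (mul_nonneg (by positivity) (sub_nonneg.2 hlower))]
  exact mul_le_of_le_one_right (by positivity) (by linarith)

lemma exists_forall_abs_eval_sub_le {g : ℝ → ℝ} (hg : UniformContinuous g) (ht : 0 ≤ t) {ε : ℝ}
    (hε : 0 < ε) : ∃ s : StepFun t, ∀ x ∈ Ioc 0 t, |s.eval x - g x| ≤ ε := by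
  obtain ⟨δ, hδ, hδg⟩ := Metric.uniformContinuous_iff.1 hg ε hε
  obtain ⟨N, hN⟩ := exists_nat_gt (t / δ)
  have hN' : (0 : ℝ) < N := (by positivity : 0 ≤ t / δ).trans_lt hN
  have hN₀ : 0 < N := by exact_mod_cast hN'
  refine ⟨interpolate g ht N, fun x hx => ?_⟩
  rw [eval_interpolate g hN₀ hx]
  refine (hδg ((abs_mul_ceil_div_sub_le (hx.1.trans_le hx.2) hx.1.le hN₀).trans_lt ?_)).le
  rwa [div_lt_iff₀ hN', mul_comm, ← div_lt_iff₀ hδ]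

lemma exists_eLpNorm_sub_le {p : ℝ≥0∞} [Fact (1 ≤ p)] (hp : p ≠ ∞) {k : ℝ → ℝ}
    (hk : MemLp k p (volume.restrict (Ioc 0 t))) (ht : 0 ≤ t) {ε : ℝ≥0∞} (hε : ε ≠ 0) :
    ∃ s : StepFun t, eLpNorm (s.eval - k) p (volume.restrict (Ioc 0 t)) ≤ ε := by
  set μ := volume.restrict (Ioc 0 t) with hμ
  have hε₂ : ε / 2 ≠ 0 := by simpa using hε
  obtain ⟨g, hgc, hgk, hg, hgm⟩ := hk.exists_hasCompactSupport_eLpNorm_sub_le hp hε₂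
  have hfin : μ univ ^ p.toReal⁻¹ ≠ ∞ :=
    (ENNReal.rpow_lt_top_of_nonneg (by positivity) (by simp [hμ])).ne
  obtain ⟨η, hη, hηε⟩ := ENNReal.exists_nnreal_pos_mul_lt hfin hε₂
  obtain ⟨s, hs⟩ :=
    exists_forall_abs_eval_sub_le (hgc.uniformContinuous_of_continuous hg) ht (NNReal.coe_pos.2 hη)
  have hsg : eLpNorm (s.eval - g) p μ ≤ ε / 2 := by
    refine (eLpNorm_le_of_ae_bound (C := η) ?_).trans ?_
    · filter_upwards [self_mem_ae_restrict measurableSet_Ioc] with x hx using hs x hx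
    · rw [ENNReal.ofReal_coe_nnreal, mul_comm]
      exact hηε.le
  refine ⟨s, ?_⟩
  calc eLpNorm (s.eval - k) p μ = eLpNorm ((s.eval - g) + (g - k)) p μ := by
        rw [sub_add_sub_cancel]
    _ ≤ eLpNorm (s.eval - g) p μ + eLpNorm (g - k) p μ :=
        eLpNorm_add_le (s.memLp_eval.sub hgm).1 (hgm.sub hk).1 Fact.out
    _ ≤ ε / 2 + ε / 2 := by
        gcongr
        rwa [eLpNorm_sub_comm]
    _ = ε := ENNReal.add_halves ε

lemma exists_tendsto_eLpNorm_sub {p : ℝ≥0∞} [Fact (1 ≤ p)] (hp : p ≠ ∞) {k : ℝ → ℝ}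
    (hk : MemLp k p (volume.restrict (Ioc 0 t))) (ht : 0 ≤ t) :
    ∃ s : ℕ → StepFun t,
      Tendsto (fun m => eLpNorm ((s m).eval - k) p (volume.restrict (Ioc 0 t))) atTop (𝓝 0) := by
  choose s hs using fun m : ℕ => exists_eLpNorm_sub_le hp hk ht (ε := (m : ℝ≥0∞)⁻¹) (by simp)
  exact ⟨s, tendsto_of_tendsto_of_tendsto_of_le_of_le tendsto_const_nhds
    ENNReal.tendsto_inv_nat_nhds_zero (fun _ => zero_le) hs⟩

end StepFun

lemma exists_isWienerIntegral (hW : IsPreBrownianReal W P) {t : ℝ} (ht : 0 ≤ t) {k : ℝ → ℝ}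
    (hk : MemLp k 2 (volume.restrict (Ioc 0 t))) :
    ∃ X : Ω → ℝ, IsWienerIntegral P W t k X := by
  obtain ⟨s, hs⟩ := StepFun.exists_tendsto_eLpNorm_sub (by simp) hk ht
  have heval m : MemLp (s m).eval 2 (volume.restrict (Ioc 0 t)) := (s m).memLp_eval
  have hintegral m : MemLp ((s m).integral W) 2 P := (s m).memLp_integral hW
  have hcauchy : CauchySeq fun m => (heval m).toLp _ :=
    ((Lp.tendsto_Lp_iff_tendsto_eLpNorm'' _ heval k hk).2 hs).cauchySeq
  have hdist m n : dist ((hintegral m).toLp _) ((hintegral n).toLp _) =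
      dist ((heval m).toLp _) ((heval n).toLp _) := by
    simp only [dist_eq_norm, ← MemLp.toLp_sub, Lp.norm_toLp, ← StepFun.eval_sub,
      ← StepFun.integral_sub, StepFun.eLpNorm_integral _ hW, max_self]
  obtain ⟨X, hX⟩ : ∃ X, Tendsto (fun m => (hintegral m).toLp _) atTop (𝓝 X) := by
    refine cauchySeq_tendsto_of_complete ?_
    simpa only [Metric.cauchySeq_iff, hdist] using hcauchy
  refine ⟨X, hk, Lp.memLp X, s, hs, ?_⟩
  rwa [← Lp.toLp_coeFn X (Lp.memLp X), Lp.tendsto_Lp_iff_tendsto_eLpNorm''] at hX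

namespace IsWienerIntegral

variable {t t' : ℝ} {k k' : ℝ → ℝ} {X X' Y : Ω → ℝ}

lemma sub (hW : IsPreBrownianReal W P) (h : IsWienerIntegral P W t k X)
    (h' : IsWienerIntegral P W t' k' X') :
    IsWienerIntegral P W (max t t') ((Ioc 0 t).indicator k - (Ioc 0 t').indicator k')
      (X - X') := by
  obtain ⟨hk, hX, s, hsk, hsX⟩ := h
  obtain ⟨hk', hX', s', hsk', hsX'⟩ := h'
  have hind {t : ℝ} {k : ℝ → ℝ} (s : StepFun t) :
      eLpNorm (fun x => s.eval x - k x) 2 (volume.restrict (Ioc 0 t)) =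
      eLpNorm (s.eval - (Ioc 0 t).indicator k) 2 volume := by
    rw [← eLpNorm_indicator_eq_eLpNorm_restrict measurableSet_Ioc]
    conv_rhs => rw [← s.indicator_eval, ← indicator_sub']
    rfl
  simp_rw [hind] at hsk hsk'
  rw [← memLp_indicator_iff_restrict measurableSet_Ioc] at hk hk'
  refine ⟨(hk.sub hk').restrict _, hX.sub hX', fun m => (s m).sub (s' m), ?_, ?_⟩
  · refine tendsto_of_tendsto_of_tendsto_of_le_of_le tendsto_const_nhds
      (by simpa using hsk.add hsk') (fun _ => zero_le) fun m => ?_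
    refine (eLpNorm_mono_measure _ Measure.restrict_le_self).trans ?_
    refine le_trans (le_of_eq ?_)
      (eLpNorm_sub_le (((s m).memLp_eval.sub hk).1) (((s' m).memLp_eval.sub hk').1) one_le_two)
    congr 1
    ext x
    simp only [StepFun.eval_sub, Pi.sub_apply]
    ring
  · refine tendsto_of_tendsto_of_tendsto_of_le_of_le tendsto_const_nhds
      (by simpa using hsX.add hsX') (fun _ => zero_le) fun m => ?_
    refine le_trans (le_of_eq ?_) (eLpNorm_sub_le (((s m).memLp_integral hW).sub hX).1
      (((s' m).memLp_integral hW).sub hX').1 one_le_two)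
    congr 1
    ext ω
    simp only [StepFun.integral_sub, Pi.sub_apply]
    ring

lemma eLpNorm_eq (hW : IsPreBrownianReal W P) (h : IsWienerIntegral P W t k X) :
    eLpNorm X 2 P = eLpNorm k 2 (volume.restrict (Ioc 0 t)) := by
  obtain ⟨hk, hX, s, hsk, hsX⟩ := h
  refine tendsto_nhds_unique
    (tendsto_eLpNorm_of_tendsto_eLpNorm_sub (fun m => (s m).memLp_integral hW) hX hsX) ?_
  simp_rw [StepFun.eLpNorm_integral _ hW]
  exact tendsto_eLpNorm_of_tendsto_eLpNorm_sub (fun m => (s m).memLp_eval) hk hsk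

lemma eLpNorm_sub (hW : IsPreBrownianReal W P) (h : IsWienerIntegral P W t k X)
    (h' : IsWienerIntegral P W t' k' X') :
    eLpNorm (X - X') 2 P =
      eLpNorm ((Ioc 0 t).indicator k - (Ioc 0 t').indicator k') 2 volume := by
  rw [(h.sub hW h').eLpNorm_eq hW, ← eLpNorm_indicator_eq_eLpNorm_restrict measurableSet_Ioc,
    indicator_sub', indicator_indicator, indicator_indicator,
    inter_eq_right.2 (Ioc_subset_Ioc_right (le_max_left t t')),
    inter_eq_right.2 (Ioc_subset_Ioc_right (le_max_right t t'))]

lemma congr_ae (h : IsWienerIntegral P W t k X) (hXY : X =ᵐ[P] Y) :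
    IsWienerIntegral P W t k Y := by
  obtain ⟨hk, hX, s, hsk, hsX⟩ := h
  refine ⟨hk, hX.ae_eq hXY, s, hsk, hsX.congr fun m => eLpNorm_congr_ae ?_⟩
  filter_upwards [hXY] with ω hω
  rw [hω]

end IsWienerIntegral

end WienerIntegral

/-! ### Jointly measurable versions of curves in `Lᵖ` -/

section Version

variable {Y E : Type*} {mY : MeasurableSpace Y} {μ : Measure Y} [NormedAddCommGroup E]
  [CompleteSpace E] {p : ℝ≥0∞}

lemma ae_tendsto_of_eLpNorm_sub_lt_two_inv_pow (hp : 1 ≤ p) {f : ℕ → Y → E} {g : Y → E}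
    (hf : ∀ m, AEStronglyMeasurable (f m) μ) (hg : AEStronglyMeasurable g μ)
    (hfg : ∀ m, eLpNorm (f m - g) p μ < 2⁻¹ ^ m) :
    ∀ᵐ y ∂μ, Tendsto (fun m => f m y) atTop (𝓝 (g y)) := by
  have hgeom : ∑' m : ℕ, (2⁻¹ ^ m : ℝ≥0∞) = 2 := by
    rw [ENNReal.tsum_geometric, ENNReal.one_sub_inv_two, inv_inv]
  have hcauchy : ∀ N n m, N ≤ n → N ≤ m → eLpNorm (f n - f m) p μ < 2 * 2⁻¹ ^ N := by
    intro N n m hn hm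
    have hle {n : ℕ} (hn : N ≤ n) : eLpNorm (f n - g) p μ < 2⁻¹ ^ N :=
      (hfg n).trans_le (pow_le_pow_right_of_le_one' (by simp) hn)
    calc eLpNorm (f n - f m) p μ = eLpNorm ((f n - g) - (f m - g)) p μ := by
          rw [sub_sub_sub_cancel_right]
      _ ≤ eLpNorm (f n - g) p μ + eLpNorm (f m - g) p μ :=
          eLpNorm_sub_le ((hf n).sub hg) ((hf m).sub hg) hp
      _ < 2⁻¹ ^ N + 2⁻¹ ^ N := ENNReal.add_lt_add (hle hn) (hle hm)
      _ = 2 * 2⁻¹ ^ N := (two_mul _).symm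
  have hmeasure : TendstoInMeasure μ f atTop g := by
    refine tendstoInMeasure_of_tendsto_eLpNorm (one_pos.trans_le hp).ne' hf hg ?_
    exact tendsto_of_tendsto_of_tendsto_of_le_of_le tendsto_const_nhds
      (ENNReal.tendsto_atTop_zero_of_tsum_ne_top (by simp [hgeom]))
      (fun _ => zero_le) fun m => (hfg m).le
  obtain ⟨ns, hns, hsub⟩ := hmeasure.exists_seq_tendsto_ae
  filter_upwards [hsub, Lp.ae_tendsto_of_cauchy_eLpNorm hf hp
    (by rw [ENNReal.tsum_mul_left, hgeom]; finiteness) hcauchy] with y hy ⟨l, hl⟩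
  rwa [tendsto_nhds_unique hy (hl.comp hns.tendsto_atTop)]

-- Replace `X s` by the first member of a dense sequence within `2⁻ᵐ` of it: the choice depends
-- measurably on `s`, and at this rate `Lᵖ` convergence implies convergence almost everywhere.
lemma exists_stronglyMeasurable_version [Fact (1 ≤ p)] {S : Type*} [MeasurableSpace S]
    {X : S → Lp E p μ} (hX : StronglyMeasurable X) :
    ∃ Z : S → Y → E, StronglyMeasurable (Function.uncurry Z) ∧ ∀ s, X s =ᵐ[μ] Z s := by
  classical
  obtain ⟨c, hc, hXc⟩ := hX.isSeparable_range
  obtain ⟨e, hce⟩ := countable_iff_exists_subset_range.1 hc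
  have hex (m : ℕ) (s : S) : ∃ n, edist (e n) (X s) < 2⁻¹ ^ m := by
    obtain ⟨x, hxc, hx⟩ := EMetric.mem_closure_iff.1 (hXc (mem_range_self s)) (2⁻¹ ^ m)
      (ENNReal.pow_pos (by simp) m)
    obtain ⟨n, rfl⟩ := hce hxc
    exact ⟨n, by rwa [edist_comm]⟩
  have hnearest (m : ℕ) : Measurable fun s => Nat.find (hex m s) :=
    measurable_find _ fun n => measurableSet_lt
      (stronglyMeasurable_const.edist hX).measurable measurable_const
  have hjoint : StronglyMeasurable (Function.uncurry fun n y => e n y) :=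
    stronglyMeasurable_uncurry_of_continuous_of_stronglyMeasurable
      (fun _ => continuous_of_discreteTopology) fun n => Lp.stronglyMeasurable (e n)
  refine ⟨fun s y => limUnder atTop fun m => e (Nat.find (hex m s)) y, ?_, fun s => ?_⟩
  · exact StronglyMeasurable.limUnder fun m =>
      hjoint.comp_measurable (((hnearest m).comp measurable_fst).prodMk measurable_snd)
  · filter_upwards [ae_tendsto_of_eLpNorm_sub_lt_two_inv_pow Fact.out
      (f := fun m => e (Nat.find (hex m s)))
      (fun _ => Lp.aestronglyMeasurable _) (Lp.aestronglyMeasurable (X s))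
      fun m => (Lp.edist_def _ _).symm.trans_lt (Nat.find_spec (hex m s))] with y hy
    exact hy.limUnder_eq.symm

end Version

/-! ### Stochastic convolution -/

section Reflection

lemma measurePreserving_sub_left_Ioc (t : ℝ) :
    MeasurePreserving (fun τ => t - τ) (volume.restrict (Ioc 0 t)) (volume.restrict (Ioc 0 t)) := by
  have h := (Measure.measurePreserving_sub_left volume t).restrict_preimage
    (measurableSet_Ioc (a := 0) (b := t))
  rwa [preimage_const_sub_Ioc, sub_self, sub_zero, restrict_Ico_eq_restrict_Ioc] at h

lemma eLpNorm_comp_sub_left_Ioc {E : Type*} [NormedAddCommGroup E] {k : ℝ → E} {t : ℝ} {p : ℝ≥0∞}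
    (hk : AEStronglyMeasurable k (volume.restrict (Ioc 0 t))) :
    eLpNorm (fun τ => k (t - τ)) p (volume.restrict (Ioc 0 t)) =
      eLpNorm k p (volume.restrict (Ioc 0 t)) :=
  eLpNorm_comp_measurePreserving hk (measurePreserving_sub_left_Ioc t)

lemma indicator_Ioc_comp_sub_left {E : Type*} [Zero E] (k : ℝ → E) {t T : ℝ} (ht : t ≤ T) :
    (Ioc 0 t).indicator (fun τ => k (t - τ)) =
      (Ioi 0).indicator fun τ => (Ico 0 T).indicator k (t - τ) := by
  ext τ
  simp only [indicator_apply, mem_Ioc, mem_Ioi, mem_Ico, ← ite_and]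
  exact if_congr (by grind) rfl rfl

lemma continuous_toLp_comp_sub_left {G E : Type*} [AddGroup G] [TopologicalSpace G]
    [IsTopologicalAddGroup G] [MeasurableSpace G] [BorelSpace G] {μ : Measure G}
    [μ.IsAddLeftInvariant] [μ.IsNegInvariant] [IsLocallyFiniteMeasure μ]
    [μ.InnerRegularCompactLTTop] [NormedAddCommGroup E] {p : ℝ≥0∞} [Fact (1 ≤ p)] (hp : p ≠ ∞)
    {k : G → E} (hk : MemLp k p μ) :
    Continuous fun t =>
      (hk.comp_measurePreserving (Measure.measurePreserving_sub_left μ t)).toLp := by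
  have hsub : Continuous fun t : G => (⟨fun x => t - x, by fun_prop⟩ : C(G, G)) :=
    ContinuousMap.continuous_of_continuous_uncurry _ continuous_sub
  exact (continuous_const (y := hk.toLp)).compMeasurePreservingLp hsub
    (Measure.measurePreserving_sub_left μ) hp

end Reflection

section StochasticConvolution

variable {Ω : Type*} {mΩ : MeasurableSpace Ω} {P : Measure Ω} {W : ℝ≥0 → Ω → ℝ} {T : ℝ}
  {k : ℝ → ℝ}

lemma eLpNorm_sub_le_of_isWienerIntegral_comp_sub_left (hW : IsPreBrownianReal W P)
    {t s : ℝ} (ht : t ≤ T) (hs : s ≤ T) {X Y : Ω → ℝ}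
    (hX : IsWienerIntegral P W t (fun τ => k (t - τ)) X)
    (hY : IsWienerIntegral P W s (fun τ => k (s - τ)) Y) :
    eLpNorm (X - Y) 2 P ≤
      eLpNorm (fun x => (Ico 0 T).indicator k (t - x) - (Ico 0 T).indicator k (s - x)) 2 := by
  rw [hX.eLpNorm_sub hW hY, indicator_Ioc_comp_sub_left k ht, indicator_Ioc_comp_sub_left k hs,
    ← indicator_sub']
  exact eLpNorm_indicator_le _

-- By the Itô isometry the Wiener integrals inherit continuity in `t` from the translates of `k`
-- in `L²`, so they form a continuous curve in `L²(P)`.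
lemma exists_measurable_isWienerIntegral_comp_sub_left (hW : IsPreBrownianReal W P)
    (hT : 0 ≤ T) (hk : MemLp k 2 (volume.restrict (Ioc 0 T))) :
    ∃ J : ℝ → Ω → ℝ, Measurable (Function.uncurry J) ∧ ∀ t ∈ Icc 0 T,
      IsWienerIntegral P W t (fun τ => k (t - τ)) (J t) := by
  have hkt (t : Icc 0 T) : MemLp (fun τ => k (t - τ)) 2 (volume.restrict (Ioc 0 (t : ℝ))) :=
    (hk.mono_measure (Measure.restrict_mono (Ioc_subset_Ioc_right t.2.2) le_rfl)
      ).comp_measurePreserving (measurePreserving_sub_left_Ioc t)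
  choose X hX using fun t : Icc 0 T => exists_isWienerIntegral hW t.2.1 (hkt t)
  have hK : MemLp ((Ico 0 T).indicator k) 2 := by
    rwa [memLp_indicator_iff_restrict measurableSet_Ico, restrict_Ico_eq_restrict_Ioc]
  have hcont : Continuous fun t => (hX t).2.1.toLp := by
    refine continuous_iff_continuousAt.2 fun s => tendsto_iff_edist_tendsto_0.2 ?_
    have htrans := ((continuous_toLp_comp_sub_left (by simp) hK).comp
      continuous_subtype_val).tendsto s
    refine tendsto_of_tendsto_of_tendsto_of_le_of_le tendsto_const_nhds
      (tendsto_iff_edist_tendsto_0.1 htrans) (fun _ => zero_le) fun t => ?_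
    simp only [Function.comp, Lp.edist_toLp_toLp]
    exact eLpNorm_sub_le_of_isWienerIntegral_comp_sub_left hW t.2.2 s.2.2 (hX t) (hX s)
  obtain ⟨Z, hZ, hXZ⟩ := exists_stronglyMeasurable_version hcont.stronglyMeasurable
  refine ⟨fun t => Z (projIcc 0 T hT t), hZ.measurable.comp
    (((continuous_projIcc (h := hT)).measurable.comp measurable_fst).prodMk measurable_snd),
    fun t ht => ?_⟩
  simp only [projIcc_of_mem hT ht]
  exact (hX ⟨t, ht⟩).congr_ae ((hX ⟨t, ht⟩).2.1.coeFn_toLp.symm.trans (hXZ _))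

end StochasticConvolution

/-! ### Integral bounds for the Mittag-Leffler kernel -/

lemma eLpNorm_two_sq {X E : Type*} {mX : MeasurableSpace X} {μ : Measure X}
    [NormedAddCommGroup E] (f : X → E) : eLpNorm f 2 μ ^ 2 = ∫⁻ x, ‖f x‖ₑ ^ 2 ∂μ := by
  simpa using eLpNorm_nnreal_pow_eq_lintegral (f := f) (μ := μ) (p := 2) two_ne_zero

section KernelBounds

variable {α lam t : ℝ}

lemma eLpNorm_mlKernel_sq_le (hα : 1 / 2 < α) (hα₁ : α ≤ 1) (hlam : 0 ≤ lam) (ht : 0 ≤ t) :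
    eLpNorm (mlKernel α lam) 2 (volume.restrict (Ioc 0 t)) ^ 2 ≤
      ENNReal.ofReal (t ^ (2 * α - 1) / ((2 * α - 1) * Real.Gamma α ^ 2)) := by
  have hα₀ : 0 < α := by linarith
  have hint : IntegrableOn (fun s => s ^ (2 * α - 2)) (Ioc 0 t) :=
    (intervalIntegrable_iff_integrableOn_Ioc_of_le ht).1
      (intervalIntegral.intervalIntegrable_rpow' (by linarith))
  calc eLpNorm (mlKernel α lam) 2 (volume.restrict (Ioc 0 t)) ^ 2
      = ∫⁻ s in Ioc 0 t, ‖mlKernel α lam s‖ₑ ^ 2 := eLpNorm_two_sq _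
    _ ≤ ∫⁻ s in Ioc 0 t, ENNReal.ofReal (s ^ (2 * α - 2) / Real.Gamma α ^ 2) := by
        refine setLIntegral_mono' measurableSet_Ioc fun s ⟨hs, _⟩ => ?_
        have hk := (mlKernel_pos hα₀ hα₁ hlam hs).le
        rw [Real.enorm_of_nonneg hk, ← ENNReal.ofReal_pow hk]
        refine ENNReal.ofReal_le_ofReal ((pow_le_pow_left₀ hk (mlKernel_le hα₀ hα₁ hlam hs) 2
          ).trans_eq ?_)
        rw [mul_pow, ← Real.rpow_mul_natCast hs.le, inv_pow, inv_mul_eq_div]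
        push_cast
        ring_nf
    _ = ENNReal.ofReal (∫ s in Ioc 0 t, s ^ (2 * α - 2) / Real.Gamma α ^ 2) := by
        refine (ofReal_integral_eq_lintegral_ofReal (hint.div_const _) ?_).symm
        filter_upwards [self_mem_ae_restrict measurableSet_Ioc] with s ⟨hs, _⟩
        exact div_nonneg (Real.rpow_nonneg hs.le _) (sq_nonneg _)
    _ = ENNReal.ofReal (t ^ (2 * α - 1) / ((2 * α - 1) * Real.Gamma α ^ 2)) := by
        rw [integral_div, ← intervalIntegral.integral_of_le ht,
          integral_rpow (Or.inl (by linarith)), show 2 * α - 2 + 1 = 2 * α - 1 by ring,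
          Real.zero_rpow (by linarith), sub_zero, div_div]

lemma memLp_mlKernel (hα : 1 / 2 < α) (hα₁ : α ≤ 1) (hlam : 0 ≤ lam) (ht : 0 ≤ t) :
    MemLp (mlKernel α lam) 2 (volume.restrict (Ioc 0 t)) :=
  ⟨(measurable_mlKernel (by linarith)).aestronglyMeasurable, by
    have h := (eLpNorm_mlKernel_sq_le hα hα₁ hlam ht).trans_lt ENNReal.ofReal_lt_top
    simpa using h⟩

lemma lintegral_enorm_mlKernel_le (hα : 0 < α) (hα₁ : α ≤ 1) (hlam : 0 < lam) (ht : 0 < t) :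
    ∫⁻ s in Ioc 0 t, ‖mlKernel α lam s‖ₑ ≤ ENNReal.ofReal lam⁻¹ := by
  have hint := (intervalIntegrable_iff_integrableOn_Ioc_of_le ht.le).1
    (intervalIntegrable_mlKernel (lam := lam) hα ht)
  have hnorm : ∫ s in Ioc 0 t, ‖mlKernel α lam s‖ = ∫ s in Ioc 0 t, mlKernel α lam s :=
    setIntegral_congr_fun measurableSet_Ioc fun s hs =>
      Real.norm_of_nonneg (mlKernel_pos hα hα₁ hlam.le hs.1).le
  rw [← ofReal_integral_norm_eq_lintegral_enorm hint, hnorm,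
    ← intervalIntegral.integral_of_le ht.le]
  exact ENNReal.ofReal_le_ofReal (integral_mlKernel_le hα hα₁ hlam ht)

end KernelBounds

/-! ### Expansions in a Hilbert basis -/

section Hilbert

variable {ι 𝕜 E : Type*} [RCLike 𝕜] [NormedAddCommGroup E] [InnerProductSpace 𝕜 E]
  (b : HilbertBasis ι 𝕜 E)

lemma repr_eq_of_hasSum_smul {c : ι → 𝕜} {u : E} (h : HasSum (fun i => c i • b i) u) (i : ι) :
    b.repr u i = c i := by
  have hinner := h.mapL (innerSL 𝕜 (b i))
  have hsingle := hasSum_single (f := fun j => c j * inner 𝕜 (b i) (b j)) i fun j hj => by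
    rw [b.orthonormal.2 hj.symm, mul_zero]
  rw [inner_self_eq_one_of_norm_eq_one (b.orthonormal.1 i), mul_one] at hsingle
  simp only [innerSL_apply_apply, inner_smul_right] at hinner
  rw [b.repr_apply_apply, hinner.unique hsingle]

lemma tsum_enorm_inner_sq (u : E) : ∑' i, ‖inner 𝕜 u (b i)‖ₑ ^ 2 = ‖u‖ₑ ^ 2 := by
  have h := RCLike.hasSum_re 𝕜 (b.hasSum_inner_mul_inner u u)
  simp only [inner_mul_symm_re_eq_norm, norm_mul, norm_inner_symm (b _) u, ← sq,
    inner_self_eq_norm_sq] at h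
  rw [← ofReal_norm, ← ENNReal.ofReal_pow (norm_nonneg u), ← h.tsum_eq,
    ENNReal.ofReal_tsum_of_nonneg (fun _ => sq_nonneg _) h.summable]
  exact tsum_congr fun i => by rw [ENNReal.ofReal_pow (norm_nonneg _), ofReal_norm]

lemma tsum_enorm_sq_of_hasSum_smul {c : ι → 𝕜} {u : E} (h : HasSum (fun i => c i • b i) u) :
    ∑' i, ‖c i‖ₑ ^ 2 = ‖u‖ₑ ^ 2 := by
  rw [← tsum_enorm_inner_sq b]
  refine tsum_congr fun i => ?_
  rw [← repr_eq_of_hasSum_smul b h, b.repr_apply_apply, ← ofReal_norm, norm_inner_symm, ofReal_norm]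

lemma exists_hasSum_smul {c : ι → 𝕜} (h : ∑' i, ‖c i‖ₑ ^ 2 ≠ ∞) :
    ∃ u, HasSum (fun i => c i • b i) u :=
  ⟨_, b.hasSum_repr_symm ⟨c, memℓp_gen (by simpa using ENNReal.summable_toReal h)⟩⟩

end Hilbert

/-! ### Eigenvalues -/

namespace DiffOp

variable {d : ℕ} {A : DiffOp d} {D : Set (Space d)}

/-- `𝒜`, with domain `H²(D) ∩ H¹₀(D)`, is symmetric in `L²(D)`. -/
def IsSymm (A : DiffOp d) (D : Set (Space d)) : Prop :=
  ∀ u v Au Av : L2 D, A.Maps D u Au → A.Maps D v Av → inner ℝ Au v = inner ℝ u Av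

/-- `𝒜`, with domain `H²(D) ∩ H¹₀(D)`, is positive definite in `L²(D)`. -/
def IsPosDef (A : DiffOp d) (D : Set (Space d)) : Prop :=
  ∀ u Au : L2 D, A.Maps D u Au → u ≠ 0 → 0 < inner ℝ Au u

lemma IsPosDef.eigenvalue_pos (hA : A.IsPosDef D) {u : L2 D} {l : ℝ} (hu : A.Maps D u (l • u))
    (hu₀ : u ≠ 0) : 0 < l := by
  have h := hA _ _ hu hu₀
  rw [real_inner_smul_left] at h
  exact pos_of_mul_pos_left h real_inner_self_nonneg

lemma IsSymm.eigenvalue_eq (hA : A.IsSymm D) {u v : L2 D} {l m : ℝ} (hu : A.Maps D u (l • u))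
    (hv : A.Maps D v (m • v)) (huv : inner ℝ u v ≠ 0) : l = m := by
  have h := hA _ _ _ _ hu hv
  rw [real_inner_smul_left, real_inner_smul_right] at h
  exact mul_right_cancel₀ huv h

lemma IsSymm.eigenvalue_zero_le (hA : A.IsSymm D) {lam mu : ℕ → ℝ}
    {phi psi : HilbertBasis ℕ ℝ (L2 D)} (hphi : A.IsEigensystem D lam phi)
    (hpsi : A.IsEigensystem D mu psi) (n : ℕ) : lam 0 ≤ mu n := by
  obtain ⟨m, hm⟩ : ∃ m, inner ℝ (psi n) (phi m) ≠ 0 := by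
    by_contra! horth
    have hnorm := tsum_enorm_inner_sq phi (psi n)
    simp [horth, psi.orthonormal.enorm_eq_one] at hnorm
  rw [hA.eigenvalue_eq (hpsi.eigen n) (hphi.eigen m) hm]
  exact hphi.mono (Nat.zero_le m)

lemma exists_pos_le_eigenvalue (hsymm : A.IsSymm D) (hpos : A.IsPosDef D) :
    ∃ l₀ > 0, ∀ (lam : ℕ → ℝ) (phi : HilbertBasis ℕ ℝ (L2 D)), A.IsEigensystem D lam phi →
      ∀ n, l₀ ≤ lam n := by
  by_cases hex : ∃ (mu : ℕ → ℝ) (psi : HilbertBasis ℕ ℝ (L2 D)), A.IsEigensystem D mu psi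
  · obtain ⟨mu, psi, hpsi⟩ := hex
    exact ⟨mu 0, hpos.eigenvalue_pos (hpsi.eigen 0) (psi.orthonormal.ne_zero 0),
      fun lam phi hphi => hsymm.eigenvalue_zero_le hpsi hphi⟩
  · exact ⟨1, one_pos, fun lam phi hphi => (hex ⟨lam, phi, hphi⟩).elim⟩

end DiffOp

/-! ### Deterministic convolution -/

section Young

lemma lintegral_mul_rpow_le {X : Type*} {mX : MeasurableSpace X} {μ : Measure X} {p : ℝ}
    (hp : 1 ≤ p) {f g : X → ℝ≥0∞} (hf : AEMeasurable f μ) (hg : AEMeasurable g μ) :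
    (∫⁻ x, f x * g x ∂μ) ^ p ≤ (∫⁻ x, f x ∂μ) ^ (p - 1) * ∫⁻ x, f x * g x ^ p ∂μ := by
  have hp₀ : 0 < p := by linarith
  have hq : 0 ≤ 1 - p⁻¹ := sub_nonneg.2 (inv_le_one_of_one_le₀ hp)
  have hpoint (x : X) : f x ^ (1 - p⁻¹) * (f x * g x ^ p) ^ p⁻¹ = f x * g x := by
    rw [ENNReal.mul_rpow_of_nonneg _ _ (inv_nonneg.2 hp₀.le), ← mul_assoc,
      ← ENNReal.rpow_add_of_nonneg _ _ hq (inv_nonneg.2 hp₀.le), sub_add_cancel,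
      ENNReal.rpow_one, ENNReal.rpow_rpow_inv hp₀.ne']
  have hHolder := ENNReal.lintegral_mul_norm_pow_le hf (hf.mul (hg.pow_const p)) hq
    (inv_nonneg.2 hp₀.le) (sub_add_cancel _ _)
  simp only [Pi.mul_apply, hpoint] at hHolder
  calc (∫⁻ x, f x * g x ∂μ) ^ p
      ≤ ((∫⁻ x, f x ∂μ) ^ (1 - p⁻¹) * (∫⁻ x, f x * g x ^ p ∂μ) ^ p⁻¹) ^ p := by gcongr
    _ = (∫⁻ x, f x ∂μ) ^ (p - 1) * ∫⁻ x, f x * g x ^ p ∂μ := by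
        rw [ENNReal.mul_rpow_of_nonneg _ _ hp₀.le, ← ENNReal.rpow_mul,
          ENNReal.rpow_inv_rpow hp₀.ne', sub_mul, one_mul, inv_mul_cancel₀ hp₀.ne']

lemma lintegral_lconvolution_rpow_le {G : Type*} [AddGroup G] {mG : MeasurableSpace G}
    [MeasurableAdd₂ G] [MeasurableNeg G] {μ : Measure G} [μ.IsAddLeftInvariant] [SFinite μ]
    {p : ℝ} (hp : 1 ≤ p) {f g : G → ℝ≥0∞} (hf : AEMeasurable f μ) (hg : AEMeasurable g μ) :
    ∫⁻ x, (f ⋆ₗ[μ] g) x ^ p ∂μ ≤ (∫⁻ x, f x ∂μ) ^ p * ∫⁻ x, g x ^ p ∂μ := by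
  calc ∫⁻ x, (f ⋆ₗ[μ] g) x ^ p ∂μ
      ≤ ∫⁻ x, (∫⁻ y, f y ∂μ) ^ (p - 1) * (f ⋆ₗ[μ] fun y => g y ^ p) x ∂μ :=
        lintegral_mono fun x => lintegral_mul_rpow_le hp hf (by fun_prop)
    _ = (∫⁻ y, f y ∂μ) ^ (p - 1) * ∫⁻ y, ∫⁻ x, f y * g (-y + x) ^ p ∂μ ∂μ := by
        rw [lintegral_const_mul'' _ (by fun_prop)]
        congr 1
        exact lintegral_lintegral_swap (by fun_prop)
    _ = (∫⁻ y, f y ∂μ) ^ (p - 1) * ((∫⁻ y, f y ∂μ) * ∫⁻ x, g x ^ p ∂μ) := by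
        congr 1
        rw [← lintegral_mul_const'' _ hf]
        refine lintegral_congr fun y => ?_
        have htranslate : AEMeasurable (fun x => g (-y + x)) μ := hg.comp_quasiMeasurePreserving
          (measurePreserving_add_left μ (-y)).quasiMeasurePreserving
        rw [lintegral_const_mul'' _ (htranslate.pow_const p),
          lintegral_add_left_eq_self (fun x => g x ^ p) (-y)]
    _ = (∫⁻ x, f x ∂μ) ^ p * ∫⁻ x, g x ^ p ∂μ := by
        rw [← mul_assoc]
        congr 1
        nth_rw 2 [← ENNReal.rpow_one (∫⁻ y, f y ∂μ)]
        rw [← ENNReal.rpow_add_of_nonneg _ _ (sub_nonneg.2 hp) zero_le_one, sub_add_cancel]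

end Young

section Convolution

variable {k h : ℝ → ℝ} {t T : ℝ}

lemma integral_comp_sub_left_mul_eq_integral_indicator (ht : t ∈ Icc 0 T) :
    ∫ τ in (0 : ℝ)..t, k (t - τ) * h τ =
      ∫ τ, (Ico 0 T).indicator k (t - τ) * (Ioc 0 T).indicator h τ := by
  rw [intervalIntegral.integral_of_le ht.1, ← integral_indicator measurableSet_Ioc]
  congr with τ
  by_cases hτ : τ ∈ Ioc 0 t
  · rw [indicator_of_mem hτ, indicator_of_mem (by grind), indicator_of_mem (by grind)]
  · rw [indicator_of_notMem hτ, eq_comm, mul_eq_zero, indicator_apply_eq_zero,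
      indicator_apply_eq_zero]
    grind

lemma continuous_integral_comp_sub_left_mul {p q : ℝ≥0∞} [p.HolderConjugate q] (hp : p ≠ ∞)
    (hk : MemLp k p) (hh : MemLp h q) : Continuous fun t => ∫ τ, k (t - τ) * h τ := by
  have : Fact (1 ≤ p) := ⟨ENNReal.HolderConjugate.one_le p q⟩
  have : Fact (1 ≤ q) := ⟨ENNReal.HolderConjugate.one_le q p⟩
  have hpairing (t : ℝ) : ∫ τ, k (t - τ) * h τ =
      (ContinuousLinearMap.mul ℝ ℝ).lpPairing volume p q (hk.comp_measurePreserving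
        (Measure.measurePreserving_sub_left volume t)).toLp hh.toLp := by
    rw [ContinuousLinearMap.lpPairing_eq_integral]
    refine integral_congr_ae ?_
    filter_upwards [(hk.comp_measurePreserving
      (Measure.measurePreserving_sub_left volume t)).coeFn_toLp, hh.coeFn_toLp] with τ hkτ hhτ
    rw [hkτ, hhτ]
    rfl
  simp only [hpairing]
  exact (((ContinuousLinearMap.mul ℝ ℝ).lpPairing volume p q).continuous.comp
    (continuous_toLp_comp_sub_left hp hk)).clm_apply continuous_const

lemma continuousOn_integral_comp_sub_left_mul {p q : ℝ≥0∞} [p.HolderConjugate q] (hp : p ≠ ∞)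
    (hk : MemLp k p (volume.restrict (Ioc 0 T))) (hh : MemLp h q (volume.restrict (Icc 0 T))) :
    ContinuousOn (fun t => ∫ τ in (0 : ℝ)..t, k (t - τ) * h τ) (Icc 0 T) := by
  rw [← restrict_Ico_eq_restrict_Ioc, ← memLp_indicator_iff_restrict measurableSet_Ico] at hk
  rw [← restrict_Ioc_eq_restrict_Icc, ← memLp_indicator_iff_restrict measurableSet_Ioc] at hh
  exact (continuous_integral_comp_sub_left_mul hp hk hh).continuousOn.congr
    fun t ht => integral_comp_sub_left_mul_eq_integral_indicator ht

lemma enorm_integral_comp_sub_left_mul_le {p q : ℝ≥0∞} [p.HolderConjugate q] (ht : t ∈ Icc 0 T)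
    (hk : AEStronglyMeasurable k (volume.restrict (Ioc 0 t)))
    (hh : AEStronglyMeasurable h (volume.restrict (Icc 0 T))) :
    ‖∫ τ in (0 : ℝ)..t, k (t - τ) * h τ‖ₑ ≤
      eLpNorm k p (volume.restrict (Ioc 0 t)) * eLpNorm h q (volume.restrict (Icc 0 T)) := by
  have hpres := measurePreserving_sub_left_Ioc t
  have hsub : volume.restrict (Ioc 0 t) ≤ volume.restrict (Icc 0 T) :=
    Measure.restrict_mono (Ioc_subset_Icc_self.trans (Icc_subset_Icc_right ht.2)) le_rfl
  calc ‖∫ τ in (0 : ℝ)..t, k (t - τ) * h τ‖ₑ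
      ≤ eLpNorm ((fun τ => k (t - τ)) • h) 1 (volume.restrict (Ioc 0 t)) := by
        rw [intervalIntegral.integral_of_le ht.1, eLpNorm_one_eq_lintegral_enorm]
        exact enorm_integral_le_lintegral_enorm _
    _ ≤ eLpNorm (k ∘ (t - ·)) p (volume.restrict (Ioc 0 t)) *
          eLpNorm h q (volume.restrict (Ioc 0 t)) :=
        eLpNorm_smul_le_mul_eLpNorm (hh.mono_measure hsub) (hk.comp_measurePreserving hpres)
    _ ≤ eLpNorm k p (volume.restrict (Ioc 0 t)) * eLpNorm h q (volume.restrict (Icc 0 T)) := by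
        rw [eLpNorm_comp_measurePreserving hk hpres]
        gcongr

lemma lintegral_enorm_integral_comp_sub_left_mul_sq_le
    (hk : AEMeasurable k (volume.restrict (Ioc 0 T)))
    (hh : AEMeasurable h (volume.restrict (Icc 0 T))) :
    ∫⁻ t in Icc 0 T, ‖∫ τ in (0 : ℝ)..t, k (t - τ) * h τ‖ₑ ^ 2 ≤
      (∫⁻ s in Ioc 0 T, ‖k s‖ₑ) ^ 2 * eLpNorm h 2 (volume.restrict (Icc 0 T)) ^ 2 := by
  set K : ℝ → ℝ≥0∞ := (Ico 0 T).indicator fun s => ‖k s‖ₑ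
  set H : ℝ → ℝ≥0∞ := (Ioc 0 T).indicator fun s => ‖h s‖ₑ
  have hK : AEMeasurable K := by
    rw [aemeasurable_indicator_iff measurableSet_Ico, restrict_Ico_eq_restrict_Ioc]
    exact hk.enorm
  have hH : AEMeasurable H := by
    rw [aemeasurable_indicator_iff measurableSet_Ioc, restrict_Ioc_eq_restrict_Icc]
    exact hh.enorm
  have hle : ∀ t ∈ Icc 0 T, ‖∫ τ in (0 : ℝ)..t, k (t - τ) * h τ‖ₑ ≤ (K ⋆ₗ H) t := fun t ht => by
    rw [integral_comp_sub_left_mul_eq_integral_indicator ht, lconvolution_comm, lconvolution_def]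
    refine (enorm_integral_le_lintegral_enorm _).trans_eq (lintegral_congr fun τ => ?_)
    rw [enorm_mul, enorm_indicator_eq_indicator_enorm, enorm_indicator_eq_indicator_enorm, mul_comm,
      sub_eq_neg_add]
  calc ∫⁻ t in Icc 0 T, ‖∫ τ in (0 : ℝ)..t, k (t - τ) * h τ‖ₑ ^ 2
      ≤ ∫⁻ t in Icc 0 T, (K ⋆ₗ H) t ^ 2 :=
        setLIntegral_mono' measurableSet_Icc fun t ht => pow_le_pow_left' (hle t ht) 2
    _ ≤ ∫⁻ t, (K ⋆ₗ H) t ^ 2 := setLIntegral_le_lintegral _ _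
    _ ≤ (∫⁻ s, K s) ^ 2 * ∫⁻ s, H s ^ 2 := by
        simpa using lintegral_lconvolution_rpow_le one_le_two hK hH
    _ = (∫⁻ s in Ioc 0 T, ‖k s‖ₑ) ^ 2 * eLpNorm h 2 (volume.restrict (Icc 0 T)) ^ 2 := by
        have hHsq : (fun s => H s ^ 2) = (Ioc 0 T).indicator fun s => ‖h s‖ₑ ^ 2 :=
          ((Ioc 0 T).indicator_comp_of_zero (g := (· ^ 2)) (zero_pow two_ne_zero)).symm
        rw [hHsq, lintegral_indicator measurableSet_Ico, lintegral_indicator measurableSet_Ioc,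
          restrict_Ico_eq_restrict_Ioc, restrict_Ioc_eq_restrict_Icc, eLpNorm_two_sq]

end Convolution

/-! ### The mild solution -/

lemma enorm_add_sq_le {E : Type*} [TopologicalSpace E] [ESeminormedAddMonoid E] (x y : E) :
    ‖x + y‖ₑ ^ 2 ≤ 2 * ‖x‖ₑ ^ 2 + 2 * ‖y‖ₑ ^ 2 :=
  calc ‖x + y‖ₑ ^ 2 ≤ (‖x‖ₑ + ‖y‖ₑ) ^ 2 := pow_le_pow_left' (enorm_add_le x y) 2
    _ ≤ 2 * (‖x‖ₑ ^ 2 + ‖y‖ₑ ^ 2) := by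
        have h := ENNReal.rpow_add_le_mul_rpow_add_rpow ‖x‖ₑ ‖y‖ₑ one_le_two
        norm_num at h
        exact h
    _ = 2 * ‖x‖ₑ ^ 2 + 2 * ‖y‖ₑ ^ 2 := mul_add _ _ _

lemma exists_stronglyMeasurable_hasSum_smul {X 𝕜 E : Type*} {mX : MeasurableSpace X} [RCLike 𝕜]
    [NormedAddCommGroup E] [InnerProductSpace 𝕜 E] [CompleteSpace E] (b : HilbertBasis ℕ 𝕜 E)
    {c : ℕ → X → 𝕜} (hc : ∀ n, Measurable (c n)) :
    ∃ u : X → E, StronglyMeasurable u ∧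
      ∀ x, ∑' n, ‖c n x‖ₑ ^ 2 ≠ ∞ → HasSum (fun n => c n x • b n) (u x) := by
  refine ⟨fun x => limUnder atTop fun N => ∑ n ∈ Finset.range N, c n x • b n,
    StronglyMeasurable.limUnder fun N => Finset.stronglyMeasurable_fun_sum _ fun n _ =>
      (hc n).stronglyMeasurable.smul_const _, fun x hx => ?_⟩
  obtain ⟨v, hv⟩ := exists_hasSum_smul b hx
  simpa only [hv.tendsto_sum_nat.limUnder_eq] using hv

section MildSolution

variable {d : ℕ} {D : Set (Space d)} {α T t l₀ : ℝ} {lam : ℕ → ℝ}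
  {phi : HilbertBasis ℕ ℝ (L2 D)} {f g : L2 D} {h : ℝ → ℝ} {Ω : Type*} {mΩ : MeasurableSpace Ω}
  {P : Measure Ω} {W : ℝ≥0 → Ω → ℝ}

lemma continuousOn_detCoeff (hα : 1 / 2 < α) (hα₁ : α ≤ 1) {n : ℕ} (hlam : 0 ≤ lam n) (hT : 0 ≤ T)
    (hh : MemLp h 2 (volume.restrict (Icc 0 T))) :
    ContinuousOn (detCoeff α lam phi f h n) (Icc 0 T) :=
  (continuousOn_integral_comp_sub_left_mul (by simp) (memLp_mlKernel hα hα₁ hlam hT) hh).const_mul _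

lemma tsum_enorm_detCoeff_sq_le (hα : 0 < α) (ht : t ∈ Icc 0 T)
    (hh : AEStronglyMeasurable h (volume.restrict (Icc 0 T))) {B : ℝ≥0∞}
    (hB : ∀ n, eLpNorm (mlKernel α (lam n)) 2 (volume.restrict (Ioc 0 t)) ^ 2 ≤ B) :
    ∑' n, ‖detCoeff α lam phi f h n t‖ₑ ^ 2 ≤
      ‖f‖ₑ ^ 2 * (B * eLpNorm h 2 (volume.restrict (Icc 0 T)) ^ 2) := by
  rw [← tsum_enorm_inner_sq phi, ← ENNReal.tsum_mul_right]
  refine ENNReal.tsum_le_tsum fun n => ?_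
  rw [detCoeff, enorm_mul, mul_pow]
  gcongr
  calc ‖∫ τ in (0 : ℝ)..t, mlKernel α (lam n) (t - τ) * h τ‖ₑ ^ 2
      ≤ (eLpNorm (mlKernel α (lam n)) 2 (volume.restrict (Ioc 0 t)) *
          eLpNorm h 2 (volume.restrict (Icc 0 T))) ^ 2 := by
        gcongr
        exact enorm_integral_comp_sub_left_mul_le ht (measurable_mlKernel hα).aestronglyMeasurable
          hh
    _ ≤ B * eLpNorm h 2 (volume.restrict (Icc 0 T)) ^ 2 := by
        rw [mul_pow]
        gcongr
        exact hB n

lemma lintegral_tsum_enorm_detCoeff_sq_le (hα : 1 / 2 < α) (hα₁ : α ≤ 1) (hl₀ : 0 < l₀)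
    (hlam : ∀ n, l₀ ≤ lam n) (hT : 0 < T) (hh : MemLp h 2 (volume.restrict (Icc 0 T))) :
    ∫⁻ t in Icc 0 T, ∑' n, ‖detCoeff α lam phi f h n t‖ₑ ^ 2 ≤
      ‖f‖ₑ ^ 2 * (ENNReal.ofReal l₀⁻¹ ^ 2 * eLpNorm h 2 (volume.restrict (Icc 0 T)) ^ 2) := by
  have hα₀ : 0 < α := by linarith
  have hlam₀ (n : ℕ) : 0 < lam n := hl₀.trans_le (hlam n)
  rw [lintegral_tsum fun n => ((continuousOn_detCoeff hα hα₁ (hlam₀ n).le hT.le hh).aemeasurable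
    measurableSet_Icc).enorm.pow_const 2, ← tsum_enorm_inner_sq phi, ← ENNReal.tsum_mul_right]
  refine ENNReal.tsum_le_tsum fun n => ?_
  simp only [detCoeff, enorm_mul, mul_pow]
  rw [lintegral_const_mul' _ _ (by simp)]
  gcongr
  calc ∫⁻ t in Icc 0 T, ‖∫ τ in (0 : ℝ)..t, mlKernel α (lam n) (t - τ) * h τ‖ₑ ^ 2
      ≤ (∫⁻ s in Ioc 0 T, ‖mlKernel α (lam n) s‖ₑ) ^ 2 *
          eLpNorm h 2 (volume.restrict (Icc 0 T)) ^ 2 :=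
        lintegral_enorm_integral_comp_sub_left_mul_sq_le (measurable_mlKernel hα₀).aemeasurable
          hh.1.aemeasurable
    _ ≤ ENNReal.ofReal l₀⁻¹ ^ 2 * eLpNorm h 2 (volume.restrict (Icc 0 T)) ^ 2 := by
        gcongr
        exact (lintegral_enorm_mlKernel_le hα₀ hα₁ (hlam₀ n) hT).trans
          (ENNReal.ofReal_le_ofReal (inv_anti₀ hl₀ (hlam n)))

lemma lintegral_tsum_enorm_add_inner_mul_sq_le {ι E : Type*} [Countable ι] [NormedAddCommGroup E]
    [InnerProductSpace ℝ E] (b : HilbertBasis ι ℝ E) (v : E) (hW : IsPreBrownianReal W P)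
    (a : ι → ℝ) {k : ι → ℝ → ℝ} {J : ι → Ω → ℝ} (hJ : ∀ i, IsWienerIntegral P W t (k i) (J i))
    {B : ℝ≥0∞} (hB : ∀ i, eLpNorm (k i) 2 (volume.restrict (Ioc 0 t)) ^ 2 ≤ B) :
    ∫⁻ ω, ∑' i, ‖a i + inner ℝ v (b i) * J i ω‖ₑ ^ 2 ∂P ≤
      2 * ∑' i, ‖a i‖ₑ ^ 2 + 2 * (‖v‖ₑ ^ 2 * B) := by
  have : IsProbabilityMeasure P := hW.isGaussianProcess.isProbabilityMeasure
  have hJm (i : ι) : AEMeasurable (J i) P := (hJ i).2.1.1.aemeasurable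
  rw [lintegral_tsum fun i => (((hJm i).const_mul _).const_add _).enorm.pow_const 2,
    ← tsum_enorm_inner_sq b, ← ENNReal.tsum_mul_right, ← ENNReal.tsum_mul_left,
    ← ENNReal.tsum_mul_left, ← ENNReal.tsum_add]
  refine ENNReal.tsum_le_tsum fun i => ?_
  calc ∫⁻ ω, ‖a i + inner ℝ v (b i) * J i ω‖ₑ ^ 2 ∂P
      ≤ ∫⁻ ω, (2 * ‖a i‖ₑ ^ 2 + 2 * (‖inner ℝ v (b i)‖ₑ ^ 2 * ‖J i ω‖ₑ ^ 2)) ∂P := by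
        simp only [← mul_pow, ← enorm_mul]
        exact lintegral_mono fun ω => enorm_add_sq_le _ _
    _ = 2 * ‖a i‖ₑ ^ 2 + 2 * (‖inner ℝ v (b i)‖ₑ ^ 2 * eLpNorm (J i) 2 P ^ 2) := by
        rw [lintegral_add_left measurable_const, lintegral_const, measure_univ, mul_one,
          lintegral_const_mul' _ _ (by simp), lintegral_const_mul' _ _ (by simp), eLpNorm_two_sq]
    _ ≤ 2 * ‖a i‖ₑ ^ 2 + 2 * (‖inner ℝ v (b i)‖ₑ ^ 2 * B) := by
        rw [(hJ i).eLpNorm_eq hW]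
        gcongr
        exact hB i

theorem exists_isMildSolution (hW : IsPreBrownianReal W P) (hα : 1 / 2 < α) (hα₁ : α ≤ 1)
    (hT : 0 ≤ T) (hlam : ∀ n, 0 ≤ lam n) (hh : MemLp h 2 (volume.restrict (Icc 0 T))) :
    ∃ u : ℝ → Ω → L2 D, IsMildSolution α lam phi T f g h P W u := by
  have hα₀ : 0 < α := by linarith
  choose J hJm hJ using fun n =>
    exists_measurable_isWienerIntegral_comp_sub_left hW hT (memLp_mlKernel hα hα₁ (hlam n) hT)
  let I (n : ℕ) : ℝ → ℝ := IccExtend hT ((Icc 0 T).domRestrict (detCoeff α lam phi f h n))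
  have hI (n : ℕ) : Measurable (I n) :=
    (continuousOn_detCoeff hα hα₁ (hlam n) hT hh).domRestrict.Icc_extend'.measurable
  have hcoeff (n : ℕ) : Measurable fun z : ℝ × Ω => I n z.1 + inner ℝ g (phi n) * J n z.1 z.2 :=
    ((hI n).comp measurable_fst).add ((hJm n).const_mul _)
  obtain ⟨u, hu, hsum⟩ := exists_stronglyMeasurable_hasSum_smul phi hcoeff
  refine ⟨fun t ω => u (t, ω), hu.aestronglyMeasurable, J, hJ, fun t ht => ?_⟩
  have hIt (n : ℕ) : I n t = detCoeff α lam phi f h n t := IccExtend_of_mem hT _ ht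
  have hfin : ∫⁻ ω, ∑' n, ‖I n t + inner ℝ g (phi n) * J n t ω‖ₑ ^ 2 ∂P ≠ ∞ := by
    have hB (n : ℕ) := eLpNorm_mlKernel_sq_le hα hα₁ (hlam n) ht.1
    refine ne_top_of_le_ne_top ?_ (lintegral_tsum_enorm_add_inner_mul_sq_le phi g hW (I · t)
      (fun n => hJ n t ht) fun n => (congrArg (· ^ 2)
        (eLpNorm_comp_sub_left_Ioc (measurable_mlKernel hα₀).aestronglyMeasurable)).trans_le (hB n))
    simp only [hIt]
    have hdet := tsum_enorm_detCoeff_sq_le (phi := phi) (f := f) hα₀ ht hh.1 hB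
    have hdet' := ne_top_of_le_ne_top (by finiteness [hh.2]) hdet
    finiteness
  filter_upwards [ae_lt_top (.tsum fun n =>
    ((hcoeff n).comp measurable_prodMk_left).enorm.pow_const 2) hfin] with ω hω
  simpa only [hIt] using hsum (t, ω) hω.ne

lemma lintegral_enorm_sq_le_of_hasSum {v : Ω → L2 D} {J : ℕ → Ω → ℝ} (hW : IsPreBrownianReal W P)
    (hα : 1 / 2 < α) (hα₁ : α ≤ 1) (hlam : ∀ n, 0 ≤ lam n) (ht : t ∈ Icc 0 T)
    (hJ : ∀ n, IsWienerIntegral P W t (fun τ => mlKernel α (lam n) (t - τ)) (J n))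
    (hv : ∀ᵐ ω ∂P, HasSum
      (fun n => (detCoeff α lam phi f h n t + inner ℝ g (phi n) * J n ω) • phi n) (v ω)) :
    ∫⁻ ω, ‖v ω‖ₑ ^ 2 ∂P ≤ 2 * ∑' n, ‖detCoeff α lam phi f h n t‖ₑ ^ 2 +
      2 * (‖g‖ₑ ^ 2 *
        ENNReal.ofReal (T ^ (2 * α - 1) / ((2 * α - 1) * Real.Gamma α ^ 2))) := by
  have hα₀ : 0 < α := by linarith
  have hT : 0 ≤ T := ht.1.trans ht.2
  calc ∫⁻ ω, ‖v ω‖ₑ ^ 2 ∂P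
      = ∫⁻ ω, ∑' n, ‖detCoeff α lam phi f h n t + inner ℝ g (phi n) * J n ω‖ₑ ^ 2 ∂P :=
        lintegral_congr_ae (hv.mono fun ω hω => (tsum_enorm_sq_of_hasSum_smul phi hω).symm)
    _ ≤ _ := by
        refine lintegral_tsum_enorm_add_inner_mul_sq_le phi g hW _ hJ fun n => ?_
        rw [eLpNorm_comp_sub_left_Ioc (measurable_mlKernel hα₀).aestronglyMeasurable]
        refine le_trans ?_ (eLpNorm_mlKernel_sq_le hα hα₁ (hlam n) hT)
        gcongr
        exact ht.2

lemma expectedSqNorm_eq_lintegral_lintegral [SFinite P] {u : ℝ → Ω → L2 D}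
    (hu : AEStronglyMeasurable (fun z : ℝ × Ω => u z.1 z.2)
      ((volume.restrict (Icc 0 T)).prod P)) :
    expectedSqNorm T P u = ∫⁻ t in Icc 0 T, ∫⁻ ω, ‖u t ω‖ₑ ^ 2 ∂P :=
  (lintegral_congr fun _ => eLpNorm_two_sq _).trans
    (lintegral_lintegral_swap (hu.enorm.pow_const 2)).symm

lemma ofReal_rpow_sub_one_div_mul_ofReal {c : ℝ} (hT : 0 < T) (hc : 0 ≤ c) (p : ℝ) :
    ENNReal.ofReal (T ^ (p - 1) / c) * ENNReal.ofReal T =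
      ENNReal.ofReal c⁻¹ * ENNReal.ofReal (T ^ p) := by
  rw [← ENNReal.ofReal_mul (by positivity), ← ENNReal.ofReal_mul (by positivity),
    Real.rpow_sub_one hT.ne']
  congr 1
  field_simp

theorem IsMildSolution.expectedSqNorm_le {u : ℝ → Ω → L2 D}
    (hu : IsMildSolution α lam phi T f g h P W u) (hW : IsPreBrownianReal W P) (hα : 1 / 2 < α)
    (hα₁ : α ≤ 1) (hl₀ : 0 < l₀) (hlam : ∀ n, l₀ ≤ lam n) (hT : 0 < T)
    (hh : MemLp h 2 (volume.restrict (Icc 0 T))) :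
    expectedSqNorm T P u ≤
      2 * (ENNReal.ofReal l₀⁻¹ ^ 2 * (eLpNorm h 2 (volume.restrict (Icc 0 T)) ^ 2 * ‖f‖ₑ ^ 2)) +
      2 * (ENNReal.ofReal ((2 * α - 1) * Real.Gamma α ^ 2)⁻¹ *
        (ENNReal.ofReal (T ^ (2 * α)) * ‖g‖ₑ ^ 2)) := by
  have : IsProbabilityMeasure P := hW.isGaussianProcess.isProbabilityMeasure
  have hlam₀ (n : ℕ) : 0 ≤ lam n := hl₀.le.trans (hlam n)
  have hc : 0 ≤ (2 * α - 1) * Real.Gamma α ^ 2 := mul_nonneg (by linarith) (sq_nonneg _)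
  obtain ⟨J, hJ, hsum⟩ := hu.expansion
  set B : ℝ := T ^ (2 * α - 1) / ((2 * α - 1) * Real.Gamma α ^ 2)
  calc expectedSqNorm T P u
      = ∫⁻ t in Icc 0 T, ∫⁻ ω, ‖u t ω‖ₑ ^ 2 ∂P :=
        expectedSqNorm_eq_lintegral_lintegral hu.measurable
    _ ≤ ∫⁻ t in Icc 0 T, (2 * ∑' n, ‖detCoeff α lam phi f h n t‖ₑ ^ 2 +
          2 * (‖g‖ₑ ^ 2 * ENNReal.ofReal B)) :=
        setLIntegral_mono' measurableSet_Icc fun t ht => lintegral_enorm_sq_le_of_hasSum hW hα hα₁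
          hlam₀ ht (fun n => hJ n t ht) (hsum t ht)
    _ = 2 * (∫⁻ t in Icc 0 T, ∑' n, ‖detCoeff α lam phi f h n t‖ₑ ^ 2) +
          2 * (‖g‖ₑ ^ 2 * ENNReal.ofReal B) * ENNReal.ofReal T := by
        rw [lintegral_add_right _ measurable_const, lintegral_const_mul' _ _ (by simp),
          setLIntegral_const, Real.volume_Icc, sub_zero]
    _ ≤ 2 * (‖f‖ₑ ^ 2 * (ENNReal.ofReal l₀⁻¹ ^ 2 *
            eLpNorm h 2 (volume.restrict (Icc 0 T)) ^ 2)) +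
          2 * (‖g‖ₑ ^ 2 * ENNReal.ofReal B) * ENNReal.ofReal T := by
        gcongr
        exact lintegral_tsum_enorm_detCoeff_sq_le hα hα₁ hl₀ hlam hT hh
    _ = _ := by
        rw [← mul_assoc (ENNReal.ofReal _) (ENNReal.ofReal _),
          ← ofReal_rpow_sub_one_div_mul_ofReal hT hc]
        ring

end MildSolution

end SFDE

theorem mainTheorem5_general {d : ℕ} (D : Set (SFDE.Space d)) (A : SFDE.DiffOp d)
    (hsymm : A.IsSymm D) (hpos : A.IsPosDef D) (α : ℝ) (hα : α ∈ Set.Ioc (1 / 2 : ℝ) 1) :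
    ∃ C : ℝ, 0 < C ∧
      ∀ (lam : ℕ → ℝ) (phi : HilbertBasis ℕ ℝ (SFDE.L2 D)), A.IsEigensystem D lam phi →
      ∀ (T : ℝ), 0 < T →
      ∀ (f g : SFDE.L2 D) (h : ℝ → ℝ), MemLp h 2 (volume.restrict (Set.Icc 0 T)) →
      ∀ (Ω : Type*) [MeasurableSpace Ω] (P : Measure Ω) (W : ℝ≥0 → Ω → ℝ),
        IsPreBrownianReal W P →
        (∃ u : ℝ → Ω → SFDE.L2 D, SFDE.IsMildSolution α lam phi T f g h P W u) ∧
        ∀ u : ℝ → Ω → SFDE.L2 D, SFDE.IsMildSolution α lam phi T f g h P W u →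
          SFDE.expectedSqNorm T P u ≤
            ENNReal.ofReal C *
              (eLpNorm h 2 (volume.restrict (Set.Icc 0 T)) ^ 2 * ‖f‖ₑ ^ 2
                + ENNReal.ofReal (T ^ (2 * α)) * ‖g‖ₑ ^ 2) := by
  obtain ⟨l₀, hl₀, hlam⟩ := SFDE.DiffOp.exists_pos_le_eigenvalue hsymm hpos
  set c : ℝ := ((2 * α - 1) * Real.Gamma α ^ 2)⁻¹
  have hc : 0 ≤ c := inv_nonneg.2 (mul_nonneg (by linarith [hα.1]) (sq_nonneg _))
  have hC : ENNReal.ofReal (2 * (l₀⁻¹ ^ 2 + c)) =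
      2 * (ENNReal.ofReal l₀⁻¹ ^ 2 + ENNReal.ofReal c) := by
    rw [ENNReal.ofReal_mul zero_le_two, ENNReal.ofReal_add (by positivity) hc,
      ENNReal.ofReal_pow (by positivity), ENNReal.ofReal_ofNat]
  refine ⟨2 * (l₀⁻¹ ^ 2 + c), by positivity, fun lam phi hE T hT f g h hh Ω _ P W hW =>
    ⟨SFDE.exists_isMildSolution hW hα.1 hα.2 hT.le (fun n => hl₀.le.trans (hlam lam phi hE n)) hh,
      fun u hu => (hu.expectedSqNorm_le hW hα.1 hα.2 hl₀ (hlam lam phi hE) hT hh).trans ?_⟩⟩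
  rw [hC, mul_assoc, mul_add (_ + _), mul_add 2]
  gcongr
  · exact le_self_add
  · exact le_add_self

theorem mainTheorem5 {d : ℕ} (D : Set (SFDE.Space d)) (hD : IsOpen D)
    (hDb : Bornology.IsBounded D) (A : SFDE.DiffOp d) (hA : A.IsSymmEllipticPosDef D)
    (α : ℝ) (hα : α ∈ Set.Ioo (1 / 2 : ℝ) 1) :
    ∃ C : ℝ, 0 < C ∧
      ∀ (lam : ℕ → ℝ) (phi : HilbertBasis ℕ ℝ (SFDE.L2 D)), A.IsEigensystem D lam phi →
      ∀ (T : ℝ), 0 < T →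
      ∀ (f g : SFDE.L2 D) (h : ℝ → ℝ), MemLp h ∞ (volume.restrict (Set.Icc 0 T)) →
      ∀ (Ω : Type*) [MeasurableSpace Ω] (P : Measure Ω) [IsProbabilityMeasure P]
        (W : ℝ≥0 → Ω → ℝ), IsBrownianReal W P →
        (∃ u : ℝ → Ω → SFDE.L2 D, SFDE.IsMildSolution α lam phi T f g h P W u) ∧
        ∀ u : ℝ → Ω → SFDE.L2 D, SFDE.IsMildSolution α lam phi T f g h P W u →
          SFDE.expectedSqNorm T P u ≤
            ENNReal.ofReal C *
              (eLpNorm h 2 (volume.restrict (Set.Icc 0 T)) ^ 2 * ‖f‖ₑ ^ 2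
                + ENNReal.ofReal (T ^ (2 * α)) * ‖g‖ₑ ^ 2) := by
  obtain ⟨C, hC, hbound⟩ :=
    mainTheorem5_general D A hA.symm hA.posDef α (Set.Ioo_subset_Ioc_self hα)
  exact ⟨C, hC, fun lam phi hE T hT f g h hh Ω _ P _ W hW => hbound lam phi hE T hT f g h
    (hh.mono_exponent le_top) Ω P W hW.toIsPreBrownianReal⟩
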